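/- Let $d\ge 1$, let $r\ge 3$ be an integer, and let $\beta>0$. For a finite graph $\mathcal G=(V,E)$, the Ising expectation at inverse temperature $\beta$ is $\langle F\rangle^{\mathcal G}_\beta = \frac{1}{Z}\sum_{\sigma\in\{-1,1\}^V} F(\sigma)\, e^{\beta\sum_{xy\in E}\sigma_x\sigma_y}$, with $Z=\sum_{\sigma\in\{-1,1\}^V} e^{\beta\sum_{xy\in E}\sigma_x\sigma_y}$. Let $\Lambda_R=[-R/2,R/2)^d\cap\mathbb Z^d$ with nearest-neighbour edges (free boundary conditions), and let $\mathbb T_r=(\mathbb Z/r\mathbb Z)^d$ be the discrete torus with nearest-neighbour edges. Set $\tau_\beta(x)=\lim_{R\to\infty}\langle\sigma_0\sigma_x\rangle^{\Lambda_R}_\beta$ for $x\in\mathbb Z^d$, $\tau^{\mathbb T_r}_\beta(x)=\langle\sigma_0\sigma_x\rangle^{\mathbb T_r}_\beta$ for $x\in\mathbb T_r$, and $$T^{(r)}_\beta(x)=\sum_{u\in\mathbb Z^d}\tau_\beta(x+ru)\in[0,\infty]\qquad (x\in\mathbb Z^d),$$ which is $r$-periodic in each coordinate direction and hence is also regarded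 as a function on $\mathbb T_r$. For $x\in\mathbb T_r$ let $\pi x$ be its unique representative in $\Lambda_r$, and for functions $f,g$ on $\mathbb T_r$ let $(f\star g)(x)=\sum_{y\in\mathbb T_r}f(y)g(x-y)$. Then, for every $x\in\mathbb T_r$, $$T^{(r)}_\beta(x)-\tau^{\mathbb T_r}_\beta(x)\;\le\;2\Big(T^{(r)}_\beta\star\big[(T^{(r)}_\beta)^2\,\big(T^{(r)}_\beta-(\tau_\beta\circ\pi)\big)\big]\star T^{(r)}_\beta\Big)(x),$$ as an inequality in the extended real line. -/

import Mathlib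

open scoped ENNReal

namespace IsingTorus

noncomputable section

/-! ### The Ising model on a finite graph -/

section FiniteGraph

variable {V : Type*} [Fintype V]

/-- The product `σ x * σ y` of the two spins at the end points of an edge `e = {x, y}`. -/
def edgeSpin (σ : V → ℤˣ) (e : Sym2 V) : ℝ :=
  Sym2.lift ⟨fun x y => ((σ x : ℤ) : ℝ) * ((σ y : ℤ) : ℝ), fun _ _ => mul_comm _ _⟩ e

open Classical in
/-- The Hamiltonian: minus the sum over the edges `{x, y}` of `G` of `σ x * σ y`.
A spin configuration is a map `V → ℤˣ`, where `ℤˣ = {1, -1}`. -/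
def hamiltonian (G : SimpleGraph V) (σ : V → ℤˣ) : ℝ :=
  -∑ e ∈ G.edgeFinset, edgeSpin σ e

open Classical in
/-- The partition function. -/
def partitionFunction (G : SimpleGraph V) (β : ℝ) : ℝ :=
  ∑ σ : V → ℤˣ, Real.exp (-β * hamiltonian G σ)

open Classical in
/-- The expectation of `F` at inverse temperature `β`. -/
def expectation (G : SimpleGraph V) (β : ℝ) (F : (V → ℤˣ) → ℝ) : ℝ :=
  (1 / partitionFunction G β) * ∑ σ : V → ℤˣ, F σ * Real.exp (-β * hamiltonian G σ)

/-- The two-point function of the Ising model on a finite graph. -/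
def twoPoint (G : SimpleGraph V) (β : ℝ) (x y : V) : ℝ :=
  expectation G β fun σ => ((σ x : ℤ) : ℝ) * ((σ y : ℤ) : ℝ)

end FiniteGraph

/-! ### Lattice, box and torus -/

/-- The nearest-neighbour graph on `R ^ d`: distinct points are adjacent when they differ by plus or
minus a coordinate unit vector. `R = ℤ` is the lattice, `R = ZMod r` the torus of period `r`. -/
def nearestNeighbour (d : ℕ) (R : Type*) [Ring R] : SimpleGraph (Fin d → R) :=
  SimpleGraph.fromRel fun x y => ∃ i, y = x + Pi.single i 1

/-- The box `[-R/2, R/2)^d ∩ ℤ^d`. -/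
def box (d R : ℕ) : Finset (Fin d → ℤ) :=
  Fintype.piFinset fun _ => Finset.Ico (-((R : ℤ) / 2)) (((R : ℤ) + 1) / 2)

theorem mem_box {d R : ℕ} {x : Fin d → ℤ} :
    x ∈ box d R ↔ ∀ i, -(R : ℝ) / 2 ≤ (x i : ℝ) ∧ (x i : ℝ) < (R : ℝ) / 2 := by
  simp only [box, Fintype.mem_piFinset, Finset.mem_Ico]
  refine forall_congr' fun i => ?_
  have h1 : -(R : ℝ) / 2 ≤ (x i : ℝ) ↔ -(R : ℤ) ≤ 2 * x i := by
    rw [div_le_iff₀ (by norm_num), mul_comm]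
    exact_mod_cast Iff.rfl
  have h2 : (x i : ℝ) < (R : ℝ) / 2 ↔ 2 * x i < (R : ℤ) := by
    rw [lt_div_iff₀ (by norm_num), mul_comm]
    exact_mod_cast Iff.rfl
  rw [h1, h2]
  omega

/-- The two-point function with free boundary conditions on the box, for points of `ℤ^d`
(set to `0` unless both points lie in the box). -/
def boxTwoPoint (d R : ℕ) (β : ℝ) (x y : Fin d → ℤ) : ℝ :=
  if h : x ∈ box d R ∧ y ∈ box d R then
    twoPoint ((nearestNeighbour d ℤ).induce {z | z ∈ box d R}) β ⟨x, h.1⟩ ⟨y, h.2⟩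
  else 0

/-- The infinite-volume two-point function `τ_β(x) = lim_{R → ∞} τ_β^{Λ_R}(0, x)`. -/
def bulkTwoPoint (d : ℕ) (β : ℝ) (x : Fin d → ℤ) : ℝ :=
  Filter.limUnder Filter.atTop fun R : ℕ => boxTwoPoint d R β 0 x

/-- The torus two-point function `τ_β^{𝕋_r}(x) = τ_β^{𝕋_r}(0, x)`. -/
def torusTwoPoint (d r : ℕ) [NeZero r] (β : ℝ) (x : Fin d → ZMod r) : ℝ :=
  twoPoint (nearestNeighbour d (ZMod r)) β 0 x

/-- The periodised two-point function `T_β^{(r)}(x) = ∑_{u ∈ ℤ^d} τ_β(x + r u)`, with values in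
`[0, ∞]`. -/
def periodised (d r : ℕ) (β : ℝ) (x : Fin d → ℤ) : ℝ≥0∞ :=
  ∑' u : Fin d → ℤ, ENNReal.ofReal (bulkTwoPoint d β (x + (r : ℤ) • u))

/-- The representative in the box `[-r/2, r/2)^d` of a point of the torus. -/
def rep {d r : ℕ} (x : Fin d → ZMod r) : Fin d → ℤ :=
  fun i => ((x i).val : ℤ).bmod r

theorem rep_mem_box {d r : ℕ} [NeZero r] (x : Fin d → ZMod r) : rep x ∈ box d r := by
  simp only [box, rep, Fintype.mem_piFinset, Finset.mem_Ico]
  intro i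
  have hr : 0 < r := Nat.pos_of_ne_zero (NeZero.ne r)
  exact ⟨Int.le_bmod hr, Int.bmod_lt hr⟩

theorem cast_rep {d r : ℕ} [NeZero r] (x : Fin d → ZMod r) (i : Fin d) :
    ((rep x i : ℤ) : ZMod r) = x i := by
  have h : ((((x i).val : ℤ).bmod r : ℤ) : ZMod r) = (((x i).val : ℤ) : ZMod r) := by
    rw [ZMod.intCast_eq_intCast_iff]
    exact Int.bmod_emod
  rw [rep, h]
  simp

theorem periodised_add_period (d r : ℕ) (β : ℝ) (x v : Fin d → ℤ) :
    periodised d r β (x + (r : ℤ) • v) = periodised d r β x := by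
  unfold periodised
  rw [← (Equiv.addLeft v).tsum_eq
    (fun u => ENNReal.ofReal (bulkTwoPoint d β (x + (r : ℤ) • u)))]
  simp [smul_add, add_assoc]

/-- The periodic function `T_β^{(r)}`, as a function on the torus. -/
def torusT (d r : ℕ) (β : ℝ) (x : Fin d → ZMod r) : ℝ≥0∞ :=
  periodised d r β (rep x)

/-- The function `τ_β ∘ π` on the torus: the infinite-volume two-point function at the
representative in the box. -/
def torusTau (d r : ℕ) (β : ℝ) (x : Fin d → ZMod r) : ℝ≥0∞ :=
  ENNReal.ofReal (bulkTwoPoint d β (rep x))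

/-- The subtraction `T_β^{(r)} - τ_β ∘ π` is never truncated. -/
theorem torusTau_le_torusT (d r : ℕ) (β : ℝ) (x : Fin d → ZMod r) :
    torusTau d r β x ≤ torusT d r β x := by
  have h := ENNReal.le_tsum
    (f := fun u : Fin d → ℤ => ENNReal.ofReal (bulkTwoPoint d β (rep x + (r : ℤ) • u))) 0
  simpa [torusTau, torusT, periodised] using h

/-- The torus convolution `(f ⋆ g)(x) = ∑_{y ∈ 𝕋_r} f(y) g(x - y)`. -/
def torusConv {d r : ℕ} [NeZero r] (f g : (Fin d → ZMod r) → ℝ≥0∞) : (Fin d → ZMod r) → ℝ≥0∞ :=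
  fun x => ∑ y : Fin d → ZMod r, f y * g (x - y)

end

end IsingTorus

/-! For finite `T` a stronger bound is proved: `T(x) - τ(x) ≤ 2 (T(0) - 1) (T ⋆ T)(x)`, where `τ` is
the torus two-point function. The stated right side contains this as the part of the convolution in
which the bracket is taken at `0`, because `T(0)² (T(0) - 1) ≥ T(0) - 1`. If `T` is infinite
somewhere, the right side is infinite.

The lattice is approached from the torus of period `r` through a tower of double covers, up to the
tori of period `r 2^k`. For one double cover of a finite graph let `corr₂` be the correlation summed
over the two lifts of the end point, and `loop` the correlation between the two lifts of one vertex.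
Two inequalities carry the proof.

Lower bound, `corr_mul_le_corr₂`: `corr₂ ≥ corr (1 + loop)`. The Ising model on the cover is
conditioned on the set where the two sheets agree. The four functions theorem on the lattice of such
sets compares the twisted cover with the trivial one, and its hypothesis is an instance of Ginibre's
inequality.

Upper bound, `corr₂_sub_corr_le`: `corr₂ - corr ≤ 2 ∑ corr₂ · loop · corr₂`. Edges are explored one
at a time, simultaneously on the cover and on the base. The two explorations differ when the cover
meets the second lift of something already used, and in their normalising factors. The second
discrepancy is paid for by the increase of `loop`, which the lower bound controls.

On tori `loop` is constant. Let `S` be the correlation summed over the fibres above the torus of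
period `r`. The lower bound at `0` shows that `S(0) - 1` grows by at least `loop` at each doubling,
so the upper bounds telescope into `S - τ ≤ 2 (S(0) - 1) (S ⋆ S)` (`IsDouble.plateauBound`).

Finally `S` is compared with `T`. Box correlations are at most torus correlations by monotonicity in
the edges, so a limit of such `S` bounds `T` from above. Conversely `S ≤ T` when `T` is finite, by
Lieb's inequality on a large box, since summability makes the boundary contribution vanish
(`torSum_le_torusT`). -/

namespace IsingCover

open Finset

/-! ### Positivity of spin polynomials and Ginibre's inequality. -/

/-- The real value of the spin at `x`. -/
def sp {V : Type*} (σ : V → ℤˣ) (x : V) : ℝ := ((σ x : ℤ) : ℝ)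

section Spin
variable {V : Type*} (σ ω : V → ℤˣ) (x : V)

theorem sp_sq : sp σ x * sp σ x = 1 := by
  unfold sp
  rcases Int.units_eq_one_or (σ x) with h | h <;> simp [h]

theorem sp_cases : sp σ x = 1 ∨ sp σ x = -1 := by
  unfold sp
  rcases Int.units_eq_one_or (σ x) with h | h <;> simp [h]

theorem sp_mul : sp (σ * ω) x = sp σ x * sp ω x := by simp [sp]

end Spin

/-- Nonnegative combinations of spin monomials. -/
inductive Cone {V : Type*} [Fintype V] : ((V → ℤˣ) → ℝ) → Prop
  | mono (c : ℝ) (hc : 0 ≤ c) (n : V → ℕ) : Cone fun σ => c * ∏ x, sp σ x ^ n x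
  | add (f g) : Cone f → Cone g → Cone fun σ => f σ + g σ

namespace Cone
variable {V : Type*} [Fintype V]

theorem mul {f g : (V → ℤˣ) → ℝ} (hf : Cone f) (hg : Cone g) : Cone fun σ => f σ * g σ := by
  induction hf with
  | mono c hc n =>
    induction hg with
    | mono c' hc' n' =>
      have h := Cone.mono (V := V) (c * c') (mul_nonneg hc hc') (n + n')
      refine cast (congrArg Cone (funext fun σ => ?_)) h
      simp only [Pi.add_apply, pow_add, prod_mul_distrib]
      ring
    | add f g _ _ h1 h2 =>
      refine cast (congrArg Cone (funext fun σ => ?_)) (Cone.add _ _ h1 h2)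
      ring
  | add f g _ _ h1 h2 =>
    refine cast (congrArg Cone (funext fun σ => ?_)) (Cone.add _ _ h1 h2)
    ring

theorem const {c : ℝ} (hc : 0 ≤ c) : Cone fun _ : V → ℤˣ => c := by
  simpa using Cone.mono (V := V) c hc 0

theorem spin (x : V) : Cone fun σ : V → ℤˣ => sp σ x := by
  classical
  have h := Cone.mono (V := V) 1 zero_le_one (Pi.single x 1)
  refine cast (congrArg Cone (funext fun σ => ?_)) h
  rw [one_mul, Fintype.prod_eq_single x]
  · simp
  · intro y hy
    simp [Pi.single_eq_of_ne hy]

theorem affine {c d : ℝ} (hc : 0 ≤ c) (hd : 0 ≤ d) (x y : V) :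
    Cone fun σ : V → ℤˣ => c + d * (sp σ x * sp σ y) :=
  Cone.add _ _ (const hc) ((const hd).mul ((spin x).mul (spin y)))

theorem prod {κ : Type*} (F : Finset κ) {f : κ → (V → ℤˣ) → ℝ} (h : ∀ i ∈ F, Cone (f i)) :
    Cone fun σ => ∏ i ∈ F, f i σ := by
  classical
  induction F using Finset.induction_on with
  | empty => simpa using const (V := V) zero_le_one
  | insert i F hi ih =>
    simp only [prod_insert hi]
    exact (h i (mem_insert_self _ _)).mul (ih fun j hj => h j (mem_insert_of_mem hj))

/-- The sum of a monomial factorises over the vertices; each factor is `2` or `0` according to the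
parity of the exponent. -/
theorem sum_nonneg [DecidableEq V] {f : (V → ℤˣ) → ℝ} (hf : Cone f) : 0 ≤ ∑ σ, f σ := by
  induction hf with
  | mono c hc n =>
    rw [← mul_sum]
    refine mul_nonneg hc ?_
    have h := Finset.prod_univ_sum (fun _ : V => (univ : Finset ℤˣ))
      (fun x s => (((s : ℤ) : ℝ)) ^ n x)
    rw [Fintype.piFinset_univ] at h
    change 0 ≤ ∑ σ : V → ℤˣ, ∏ x, ((σ x : ℤ) : ℝ) ^ n x
    rw [← h]
    refine prod_nonneg fun x _ => ?_
    have : (univ : Finset ℤˣ) = {1, -1} := by decide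
    rw [this, sum_pair (by decide)]
    rcases Nat.even_or_odd (n x) with hn | hn
    · simp [hn.neg_one_pow]
    · simp [hn.neg_one_pow]
  | add f g _ _ h1 h2 =>
    rw [sum_add_distrib]
    exact add_nonneg h1 h2

end Cone

section Ising
variable {V ι : Type*} (a b : ι → V)

/-- The product of the edge weights `1 + c σ_a σ_b` over the edges in `F`. -/
def wt (c : ι → ℝ) (F : Finset ι) (σ : V → ℤˣ) : ℝ :=
  ∏ i ∈ F, (1 + c i * (sp σ (a i) * sp σ (b i)))

variable [Fintype V] [DecidableEq V]

/-- The unnormalised two-point function. -/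
def num (c : ι → ℝ) (F : Finset ι) (x y : V) : ℝ :=
  ∑ σ : V → ℤˣ, sp σ x * sp σ y * wt a b c F σ

/-- The partition function. -/
def part (c : ι → ℝ) (F : Finset ι) : ℝ := ∑ σ : V → ℤˣ, wt a b c F σ

/-- The two-point function with equal edge weights `t`. -/
noncomputable def corr (t : ℝ) (F : Finset ι) (x y : V) : ℝ :=
  num a b (fun _ => t) F x y / part a b (fun _ => t) F

variable {a b}

theorem num_self (c : ι → ℝ) (F : Finset ι) (x : V) : num a b c F x x = part a b c F := by
  simp [num, part, sp_sq]

theorem num_comm (c : ι → ℝ) (F : Finset ι) (x y : V) : num a b c F x y = num a b c F y x := by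
  simp only [num, mul_comm (sp _ x)]

omit [Fintype V] [DecidableEq V] in
theorem edge_nonneg {c : ℝ} (hc : |c| ≤ 1) (σ : V → ℤˣ) (x y : V) :
    0 ≤ 1 + c * (sp σ x * sp σ y) := by
  obtain ⟨h1, h2⟩ := abs_le.1 hc
  rcases sp_cases σ x with h | h <;> rcases sp_cases σ y with h' | h' <;>
    rw [h, h'] <;> linarith

omit [Fintype V] [DecidableEq V] in
theorem edge_pos {c : ℝ} (hc : |c| < 1) (σ : V → ℤˣ) (x y : V) :
    0 < 1 + c * (sp σ x * sp σ y) := by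
  obtain ⟨h1, h2⟩ := abs_lt.1 hc
  rcases sp_cases σ x with h | h <;> rcases sp_cases σ y with h' | h' <;>
    rw [h, h'] <;> linarith

theorem part_nonneg {c : ι → ℝ} (hc : ∀ i, |c i| ≤ 1) (F : Finset ι) : 0 ≤ part a b c F :=
  sum_nonneg fun σ _ => prod_nonneg fun i _ => edge_nonneg (hc i) σ _ _

theorem part_pos {c : ι → ℝ} (hc : ∀ i, |c i| < 1) (F : Finset ι) : 0 < part a b c F :=
  sum_pos (fun σ _ => prod_pos fun i _ => edge_pos (hc i) σ _ _) univ_nonempty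

omit [DecidableEq V] in
theorem cone_wt {c : ι → ℝ} (hc : ∀ i, 0 ≤ c i) (F : Finset ι) : Cone (wt a b c F) :=
  Cone.prod F fun i _ => Cone.affine zero_le_one (hc i) _ _

theorem num_nonneg {c : ι → ℝ} (hc : ∀ i, 0 ≤ c i) (F : Finset ι) (x y : V) :
    0 ≤ num a b c F x y :=
  (((Cone.spin x).mul (Cone.spin y)).mul (cone_wt hc F)).sum_nonneg

-- The difference and the sum must be treated together: a new factor with sign `-1` feeds each of
-- them into the other.
omit [DecidableEq V] in
theorem cone_prod_sub_add {c : ι → ℝ} (hc : ∀ i, 0 ≤ c i) {k : ι → ℝ} (hk : ∀ i, k i = 1 ∨ k i = -1)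
    (G : Finset ι) :
    Cone (fun σ : V → ℤˣ => (∏ i ∈ G, (1 + c i * (sp σ (a i) * sp σ (b i)))) -
      ∏ i ∈ G, (1 + c i * k i * (sp σ (a i) * sp σ (b i)))) ∧
    Cone (fun σ : V → ℤˣ => (∏ i ∈ G, (1 + c i * (sp σ (a i) * sp σ (b i)))) +
      ∏ i ∈ G, (1 + c i * k i * (sp σ (a i) * sp σ (b i)))) := by
  classical
  induction G using Finset.induction_on with
  | empty =>
    simp only [prod_empty]
    exact ⟨Cone.const (by norm_num), Cone.const (by norm_num)⟩
  | insert i G hi ih =>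
    obtain ⟨h1, h2⟩ := ih
    have e : Cone fun σ : V → ℤˣ => c i * (sp σ (a i) * sp σ (b i)) :=
      (Cone.const (hc i)).mul ((Cone.spin _).mul (Cone.spin _))
    simp only [prod_insert hi]
    rcases hk i with h | h <;> rw [h]
    · constructor
      · refine cast (congrArg Cone (funext fun σ => ?_)) (Cone.add _ _ h1 (e.mul h1)); ring
      · refine cast (congrArg Cone (funext fun σ => ?_)) (Cone.add _ _ h2 (e.mul h2)); ring
    · constructor
      · refine cast (congrArg Cone (funext fun σ => ?_)) (Cone.add _ _ h1 (e.mul h2)); ring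
      · refine cast (congrArg Cone (funext fun σ => ?_)) (Cone.add _ _ h2 (e.mul h1)); ring

/-- Ginibre's inequality, comparing a ferromagnetic system with one with signs `s`. -/
theorem num_mul_part_le [DecidableEq ι] {c : ι → ℝ} (hc : ∀ i, 0 ≤ c i) (hc1 : ∀ i, c i ≤ 1)
    {s : ι → ℝ} (hs : ∀ i, s i = 1 ∨ s i = -1) (F₁ F₂ : Finset ι) (x y : V) :
    num a b c F₁ x y * part a b (fun i => c i * s i) F₂ ≤
      num a b c (F₁ ∪ F₂) x y * part a b (fun i => c i * s i) (F₁ ∩ F₂) := by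
  have split1 : ∀ (c : ι → ℝ) (σ : V → ℤˣ),
      wt a b c (F₁ ∪ F₂) σ = wt a b c F₁ σ * wt a b c (F₂ \ F₁) σ := by
    intro c σ
    unfold wt
    rw [← prod_union disjoint_sdiff, union_sdiff_self_eq_union]
  have split2 : ∀ (c : ι → ℝ) (σ : V → ℤˣ),
      wt a b c F₂ σ = wt a b c (F₁ ∩ F₂) σ * wt a b c (F₂ \ F₁) σ := by
    intro c σ
    unfold wt
    rw [← prod_union (by
      rw [Finset.disjoint_left]; intro i h1 h2
      exact (mem_sdiff.1 h2).2 (mem_inter.1 h1).1)]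
    congr 1
    ext i; simp only [mem_union, mem_inter, mem_sdiff]; tauto
  have split3 : ∀ (c : ι → ℝ) (σ : V → ℤˣ),
      wt a b c F₁ σ = wt a b c (F₁ ∩ F₂) σ * wt a b c (F₁ \ F₂) σ := by
    intro c σ
    unfold wt
    rw [← prod_union (by
      rw [Finset.disjoint_left]; intro i h1 h2
      exact (mem_sdiff.1 h2).2 (mem_inter.1 h1).2)]
    congr 1
    ext i; simp only [mem_union, mem_inter, mem_sdiff]; tauto
  rw [← sub_nonneg]
  -- In the duplicated system the second configuration is written `σ * ω`. For fixed `ω` the summand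
  -- is a polynomial in `σ` alone, and each of its factors lies in the cone.
  have key : num a b c (F₁ ∪ F₂) x y * part a b (fun i => c i * s i) (F₁ ∩ F₂) -
      num a b c F₁ x y * part a b (fun i => c i * s i) F₂ =
      ∑ ω : V → ℤˣ, ∑ σ : V → ℤˣ, sp σ x * sp σ y *
        (wt a b c F₁ σ * wt a b (fun i => c i * s i) (F₁ ∩ F₂) (σ * ω)) *
        (wt a b c (F₂ \ F₁) σ - wt a b (fun i => c i * s i) (F₂ \ F₁) (σ * ω)) := by
    rw [sum_comm]
    unfold num part
    rw [sum_mul_sum, sum_mul_sum, ← sum_sub_distrib]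
    refine sum_congr rfl fun σ _ => ?_
    rw [← sum_sub_distrib]
    rw [← Equiv.sum_comp (Equiv.mulLeft σ)]
    refine sum_congr rfl fun ω _ => ?_
    simp only [Equiv.coe_mulLeft, split1, split2]
    ring
  rw [key]
  refine Finset.sum_nonneg fun ω _ => Cone.sum_nonneg (Cone.mul (Cone.mul
    ((Cone.spin x).mul (Cone.spin y)) ?_) ?_)
  -- Edges in both sets carry two factors. With `e = σ_a σ_b`, `w = ω_a ω_b` and `e² = 1`, `(1 + c
  -- e)(1 + c s w e) = (1 + c² s w) + c (1 + s w) e`, and both coefficients are nonnegative because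
  -- `c ≤ 1` and `s w = ±1`.
  · have h1 : Cone fun σ : V → ℤˣ => ∏ i ∈ F₁ ∩ F₂,
        ((1 + c i ^ 2 * (s i * (sp ω (a i) * sp ω (b i)))) +
          c i * (1 + s i * (sp ω (a i) * sp ω (b i))) * (sp σ (a i) * sp σ (b i))) := by
      refine Cone.prod _ fun i _ => Cone.affine ?_ ?_ _ _
      · have : c i ^ 2 ≤ 1 := pow_le_one₀ (hc i) (hc1 i)
        have h0 : 0 ≤ c i ^ 2 := sq_nonneg _
        rcases hs i with h | h <;> rcases sp_cases ω (a i) with h' | h' <;>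
          rcases sp_cases ω (b i) with h'' | h'' <;> rw [h, h', h''] <;> linarith
      · refine mul_nonneg (hc i) ?_
        rcases hs i with h | h <;> rcases sp_cases ω (a i) with h' | h' <;>
          rcases sp_cases ω (b i) with h'' | h'' <;> rw [h, h', h''] <;> norm_num
    refine cast (congrArg Cone (funext fun σ => ?_)) (h1.mul (cone_wt (a := a) (b := b) hc (F₁ \ F₂)))
    rw [split3, mul_right_comm]
    congr 1
    unfold wt
    rw [← prod_mul_distrib]
    refine prod_congr rfl fun i _ => ?_
    rw [sp_mul, sp_mul]
    have e1 := sp_sq σ (a i)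
    have e2 := sp_sq σ (b i)
    linear_combination (-(c i ^ 2 * s i * sp ω (a i) * sp ω (b i) * sp σ (b i) * sp σ (b i))) * e1 -
      (c i ^ 2 * s i * sp ω (a i) * sp ω (b i)) * e2
  · have h := (cone_prod_sub_add (a := a) (b := b) hc
      (k := fun i => s i * (sp ω (a i) * sp ω (b i))) (fun i => by
        rcases hs i with h | h <;> rcases sp_cases ω (a i) with h' | h' <;>
          rcases sp_cases ω (b i) with h'' | h'' <;> simp [h, h', h'']) (F₂ \ F₁)).1
    refine cast (congrArg Cone (funext fun σ => ?_)) h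
    unfold wt
    congr 1
    refine prod_congr rfl fun i _ => ?_
    rw [sp_mul, sp_mul]
    ring

end Ising

end IsingCover

/-! ### One-edge recursions, Griffiths inequalities and change of vertex set. -/

namespace IsingCover

open Finset

section Ising
variable {V ι : Type*} {a b : ι → V}

/-- The edge `i` joins `x` and `y`. -/
def Joins (a b : ι → V) (i : ι) (x y : V) : Prop := a i = x ∧ b i = y ∨ a i = y ∧ b i = x

theorem Joins.sp {i : ι} {x y : V} (h : Joins a b i x y) (σ : V → ℤˣ) :
    sp σ (a i) * sp σ (b i) = sp σ x * sp σ y := by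
  rcases h with ⟨rfl, rfl⟩ | ⟨rfl, rfl⟩
  · rfl
  · exact mul_comm _ _

variable [Fintype V] [DecidableEq V]

theorem num_insert [DecidableEq ι] (c : ι → ℝ) {F : Finset ι} {i : ι} (hi : i ∉ F) {y y' : V}
    (h : Joins a b i y y') (x : V) :
    num a b c (insert i F) y x = num a b c F y x + c i * num a b c F y' x := by
  unfold num wt
  rw [mul_sum, ← sum_add_distrib]
  refine sum_congr rfl fun σ _ => ?_
  rw [prod_insert hi, h.sp]
  have := sp_sq σ y
  linear_combination (c i * sp σ y' * sp σ x *
    ∏ i ∈ F, (1 + c i * (sp σ (a i) * sp σ (b i)))) * this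

theorem part_insert [DecidableEq ι] (c : ι → ℝ) {F : Finset ι} {i : ι} (hi : i ∉ F) {y y' : V}
    (h : Joins a b i y y') :
    part a b c (insert i F) = part a b c F + c i * num a b c F y y' := by
  rw [← num_self c (insert i F) y, num_insert c hi h y, num_self, num_comm c F y' y]

theorem corr_self {t : ℝ} (ht0 : 0 ≤ t) (ht1 : t < 1) (F : Finset ι) (x : V) :
    corr a b t F x x = 1 := by
  unfold corr
  rw [num_self]
  exact div_self (part_pos (fun _ => by rw [abs_of_nonneg ht0]; exact ht1) F).ne'

theorem corr_comm (t : ℝ) (F : Finset ι) (x y : V) : corr a b t F x y = corr a b t F y x := by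
  unfold corr; rw [num_comm]

theorem corr_part_pos {t : ℝ} (ht0 : 0 ≤ t) (ht1 : t < 1) (F : Finset ι) :
    0 < part a b (fun _ => t) F :=
  part_pos (fun _ => by rw [abs_of_nonneg ht0]; exact ht1) F

theorem corr_nonneg {t : ℝ} (ht0 : 0 ≤ t) (ht1 : t < 1) (F : Finset ι) (x y : V) :
    0 ≤ corr a b t F x y :=
  div_nonneg (num_nonneg (fun _ => ht0) F x y) (corr_part_pos ht0 ht1 F).le

theorem corr_le_one {t : ℝ} (ht0 : 0 ≤ t) (ht1 : t < 1) (F : Finset ι) (x y : V) :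
    corr a b t F x y ≤ 1 := by
  refine (div_le_one (corr_part_pos ht0 ht1 F)).2 (sum_le_sum fun σ _ => ?_)
  refine mul_le_of_le_one_left (prod_nonneg fun i _ => edge_nonneg ?_ σ _ _) ?_
  · rw [abs_of_nonneg ht0]; exact ht1.le
  · rcases sp_cases σ x with h | h <;> rcases sp_cases σ y with h' | h' <;> rw [h, h'] <;> norm_num

theorem corr_mono {t : ℝ} (ht0 : 0 ≤ t) (ht1 : t < 1) {F G : Finset ι} (h : F ⊆ G) (x y : V) :
    corr a b t F x y ≤ corr a b t G x y := by
  classical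
  unfold corr
  rw [div_le_div_iff₀ (corr_part_pos ht0 ht1 F) (corr_part_pos ht0 ht1 G)]
  have := num_mul_part_le (a := a) (b := b) (c := fun _ => t) (fun _ => ht0) (fun _ => ht1.le)
    (s := fun _ => 1) (fun _ => Or.inl rfl) F G x y
  simpa [union_eq_right.2 h, inter_eq_left.2 h] using this

/-- The new weight is `1 + t σ_y σ_y'`, and `σ_y² = 1` turns its second term into a step from `y` to
`y'`. The factor on the left is the ratio of the partition functions. All explorations of the graph
rest on this recursion. -/
theorem corr_insert_mul [DecidableEq ι] {t : ℝ} (ht0 : 0 ≤ t) (ht1 : t < 1) {F : Finset ι} {i : ι}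
    (hi : i ∉ F) {y y' : V} (h : Joins a b i y y') (x : V) :
    corr a b t (insert i F) y x * (1 + t * corr a b t F y y') =
      corr a b t F y x + t * corr a b t F y' x := by
  have h1 := num_insert (fun _ => t) hi h x
  have h2 := part_insert (fun _ => t) hi h
  have p1 := corr_part_pos (a := a) (b := b) ht0 ht1 F
  have p2 := corr_part_pos (a := a) (b := b) ht0 ht1 (insert i F)
  have e : 1 + t * corr a b t F y y' =
      part a b (fun _ => t) (insert i F) / part a b (fun _ => t) F := by
    rw [h2]; unfold corr; field_simp
  rw [e]
  unfold corr
  rw [h1]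
  field_simp

theorem one_le_step {t : ℝ} (ht0 : 0 ≤ t) (ht1 : t < 1) (F : Finset ι) (x y : V) :
    1 ≤ 1 + t * corr a b t F x y :=
  le_add_of_nonneg_right (mul_nonneg ht0 (corr_nonneg ht0 ht1 F x y))

theorem corr_insert [DecidableEq ι] {t : ℝ} (ht0 : 0 ≤ t) (ht1 : t < 1) {F : Finset ι} {i : ι}
    (hi : i ∉ F) {y y' : V} (h : Joins a b i y y') (x : V) :
    corr a b t (insert i F) y x =
      (1 + t * corr a b t F y y')⁻¹ * (corr a b t F y x + t * corr a b t F y' x) := by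
  rw [← corr_insert_mul ht0 ht1 hi h x]
  have := one_le_step (a := a) (b := b) ht0 ht1 F y y'
  field_simp

/-- Exploring an edge at `y`. -/
theorem corr_erase [DecidableEq ι] {t : ℝ} (ht0 : 0 ≤ t) (ht1 : t < 1) {F : Finset ι} {i : ι}
    (hi : i ∈ F) {y y' : V} (h : Joins a b i y y') (x : V) :
    corr a b t F y x =
      (1 + t * corr a b t (F.erase i) y y')⁻¹ *
        (corr a b t (F.erase i) y x + t * corr a b t (F.erase i) y' x) := by
  conv_lhs => rw [← insert_erase hi]
  exact corr_insert ht0 ht1 (notMem_erase i F) h x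

/-- A point with no edge is uncorrelated with the others. -/
theorem corr_eq_of_isolated {t : ℝ} (ht0 : 0 ≤ t) (ht1 : t < 1) {F : Finset ι} {y : V}
    (h : ∀ i ∈ F, a i ≠ y ∧ b i ≠ y) (x : V) :
    corr a b t F y x = if y = x then 1 else 0 := by
  split_ifs with hyx
  · rw [← hyx, corr_self ht0 ht1]
  · unfold corr
    have : num a b (fun _ => t) F y x = 0 := by
      have key : num a b (fun _ => t) F y x = - num a b (fun _ => t) F y x := by
        conv_lhs => unfold num
        -- Flipping the spin at `y` alone changes no edge weight and reverses the sign of the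
        -- observable.
        rw [← Equiv.sum_comp (Equiv.mulLeft (Function.update (1 : V → ℤˣ) y (-1)))]
        unfold num
        rw [← sum_neg_distrib]
        refine sum_congr rfl fun σ _ => ?_
        have hne : ∀ z, z ≠ y → sp (Function.update (1 : V → ℤˣ) y (-1)) z = 1 := by
          intro z hz; simp [sp, Function.update_of_ne hz]
        have hy : sp (Function.update (1 : V → ℤˣ) y (-1)) y = -1 := by simp [sp]
        have hw : wt a b (fun _ => t) F (Function.update (1 : V → ℤˣ) y (-1) * σ) =
            wt a b (fun _ => t) F σ := by
          refine prod_congr rfl fun i hi => ?_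
          rw [sp_mul, sp_mul, hne _ (h i hi).1, hne _ (h i hi).2, one_mul, one_mul]
        rw [Equiv.coe_mulLeft, hw, sp_mul, sp_mul, hy, hne x (Ne.symm hyx)]
        ring
      linarith
    rw [this, zero_div]

/-- An extra edge, labelled `none`, is added between `y` and `z` with weight `1`. That the
correlation of `y` and `x` does not decrease is, after clearing denominators, exactly the claim. -/
theorem corr_mul_corr_le {t : ℝ} (ht0 : 0 ≤ t) (ht1 : t < 1) (F : Finset ι) (x y z : V) :
    corr a b t F x y * corr a b t F y z ≤ corr a b t F x z := by
  classical
  let a' : Option ι → V := fun o => o.elim y a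
  let b' : Option ι → V := fun o => o.elim z b
  let c : Option ι → ℝ := fun o => o.elim 1 fun _ => t
  let F₁ : Finset (Option ι) := F.map Function.Embedding.some
  have hn : none ∉ F₁ := by simp [F₁]
  have hJ : Joins a' b' none y z := Or.inl ⟨rfl, rfl⟩
  have hc : ∀ i, 0 ≤ c i := by
    rintro (_ | i)
    · exact zero_le_one
    · exact ht0
  have hc1 : ∀ i, c i ≤ 1 := by
    rintro (_ | i)
    · exact le_rfl
    · exact ht1.le
  have hw : ∀ σ, wt a' b' c F₁ σ = wt a b (fun _ => t) F σ := by
    intro σ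
    simp [wt, F₁, prod_map, a', b', c]
  have hnum : ∀ u v, num a' b' c F₁ u v = num a b (fun _ => t) F u v := by
    intro u v; simp only [num, hw]
  have hpart : part a' b' c F₁ = part a b (fun _ => t) F := by
    simp only [part, hw]
  have h := num_mul_part_le (a := a') (b := b') hc hc1 (s := fun _ => 1) (fun _ => Or.inl rfl)
    F₁ (insert none F₁) y x
  rw [union_eq_right.2 (subset_insert _ _), inter_eq_left.2 (subset_insert _ _)] at h
  simp only [mul_one] at h
  change num a' b' c F₁ y x * part a' b' c (insert none F₁) ≤
    num a' b' c (insert none F₁) y x * part a' b' c F₁ at h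
  rw [part_insert c hn hJ, num_insert c hn hJ x] at h
  simp only [hnum, hpart] at h
  have hc0 : c none = 1 := rfl
  rw [hc0] at h
  have p := corr_part_pos (a := a) (b := b) ht0 ht1 F
  unfold corr
  rw [div_mul_div_comm, div_le_div_iff₀ (mul_pos p p) p, num_comm _ F x y, num_comm _ F x z]
  nlinarith [mul_le_mul_of_nonneg_right h p.le]

/-- Restriction along `φ` is a surjective homomorphism of finite groups, so all its fibres have the
same size. The proof averages over translations. -/
theorem sum_comp_embedding {V' : Type*} [Fintype V'] [DecidableEq V'] {φ : V' → V}
    (hφ : Function.Injective φ) (f : (V' → ℤˣ) → ℝ) :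
    (Fintype.card (V → ℤˣ) : ℝ) * ∑ σ, f σ =
      (Fintype.card (V' → ℤˣ) : ℝ) * ∑ σ : V → ℤˣ, f (σ ∘ φ) := by
  have h1 : ∀ σ : V → ℤˣ, ∑ σ' : V' → ℤˣ, f ((σ ∘ φ) * σ') = ∑ σ', f σ' := fun σ =>
    Equiv.sum_comp (Equiv.mulLeft (σ ∘ φ)) f
  have h2 : ∀ σ' : V' → ℤˣ, ∑ σ : V → ℤˣ, f ((σ ∘ φ) * σ') = ∑ σ : V → ℤˣ, f (σ ∘ φ) := by
    intro σ'
    rw [← Equiv.sum_comp (Equiv.mulRight (Function.extend φ σ' 1)) fun σ => f (σ ∘ φ)]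
    refine sum_congr rfl fun σ _ => congrArg f ?_
    ext x
    simp [hφ.extend_apply]
  calc _ = ∑ σ : V → ℤˣ, ∑ σ' : V' → ℤˣ, f ((σ ∘ φ) * σ') := by simp [h1]
    _ = ∑ σ' : V' → ℤˣ, ∑ σ : V → ℤˣ, f ((σ ∘ φ) * σ') := sum_comm
    _ = _ := by simp [h2]

/-- The correlations do not change when the graph is embedded into a larger set of vertices. -/
theorem corr_embed {V' ι' : Type*} [Fintype V'] [DecidableEq V'] [DecidableEq ι] {a' b' : ι' → V'}
    {φ : V' → V} (hφ : Function.Injective φ) {j : ι' → ι} {F : Finset ι'} (hj : Set.InjOn j F)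
    (h : ∀ i ∈ F, Joins a b (j i) (φ (a' i)) (φ (b' i))) (t : ℝ) (x y : V') :
    corr a b t (F.image j) (φ x) (φ y) = corr a' b' t F x y := by
  have hw : ∀ σ : V → ℤˣ, wt a b (fun _ => t) (F.image j) σ = wt a' b' (fun _ => t) F (σ ∘ φ) := by
    intro σ
    unfold wt
    rw [prod_image hj]
    refine prod_congr rfl fun i hi => ?_
    rw [(h i hi).sp]
    rfl
  have h1 := sum_comp_embedding hφ fun σ => sp σ x * sp σ y * wt a' b' (fun _ => t) F σ
  have h2 := sum_comp_embedding hφ (V := V) fun σ => wt a' b' (fun _ => t) F σ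
  have e1 : num a b (fun _ => t) (F.image j) (φ x) (φ y) =
      ∑ σ : V → ℤˣ, sp (σ ∘ φ) x * sp (σ ∘ φ) y * wt a' b' (fun _ => t) F (σ ∘ φ) := by
    unfold num
    refine sum_congr rfl fun σ _ => ?_
    rw [hw]; rfl
  have e2 : part a b (fun _ => t) (F.image j) =
      ∑ σ : V → ℤˣ, wt a' b' (fun _ => t) F (σ ∘ φ) := by
    unfold part
    exact sum_congr rfl fun σ _ => hw σ
  unfold corr
  rw [e1, e2]
  have c1 : (Fintype.card (V → ℤˣ) : ℝ) ≠ 0 := by exact_mod_cast Fintype.card_ne_zero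
  have c2 : (Fintype.card (V' → ℤˣ) : ℝ) ≠ 0 := by exact_mod_cast Fintype.card_ne_zero
  rw [← mul_div_mul_left _ _ c2, ← h1, ← h2, mul_div_mul_left _ _ c1]
  rfl

end Ising

end IsingCover

/-! ### Double covers, agreement sets and the lower bound by the four functions theorem. -/

namespace IsingCover

open Finset

section Sums
variable {V : Type*}

/-- A configuration on the double cover from configurations on the two sheets. -/
def pairing (σ τ : V → ℤˣ) : V × Bool → ℤˣ := fun p => if p.2 then τ p.1 else σ p.1

theorem sp_pairing_false (σ τ : V → ℤˣ) (x : V) : sp (pairing σ τ) (x, false) = sp σ x := by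
  simp [sp, pairing]

theorem sp_pairing_true (σ τ : V → ℤˣ) (x : V) : sp (pairing σ τ) (x, true) = sp τ x := by
  simp [sp, pairing]

variable [DecidableEq V]

/-- The configuration which is `1` on `P` and `-1` off `P`. -/
def signs (P : Finset V) : V → ℤˣ := fun v => if v ∈ P then 1 else -1

theorem sp_signs (P : Finset V) (x : V) : sp (signs P) x = if x ∈ P then 1 else -1 := by
  unfold sp signs; split_ifs <;> simp

variable [Fintype V]

theorem sum_cover (f : (V × Bool → ℤˣ) → ℝ) :
    ∑ σ, f σ = ∑ σ : V → ℤˣ, ∑ τ : V → ℤˣ, f (pairing σ τ) := by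
  rw [← Fintype.sum_prod_type']
  symm
  refine Fintype.sum_bijective (fun p : (V → ℤˣ) × (V → ℤˣ) => pairing p.1 p.2) ?_ _ _ fun _ => rfl
  refine Function.bijective_iff_has_inverse.2
    ⟨fun σ => (fun v => σ (v, false), fun v => σ (v, true)), fun p => ?_, fun σ => ?_⟩
  · simp [pairing]
  · ext ⟨v, u⟩
    cases u <;> simp [pairing]

theorem sum_signs (f : (V → ℤˣ) → ℝ) : ∑ σ, f σ = ∑ P : Finset V, f (signs P) := by
  symm
  refine Fintype.sum_bijective signs ?_ _ _ fun _ => rfl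
  refine Function.bijective_iff_has_inverse.2
    ⟨fun σ => univ.filter fun v => σ v = 1, fun P => ?_, fun σ => ?_⟩
  · ext v
    by_cases h : v ∈ P <;> simp [signs, h]
  · ext v
    rcases Int.units_eq_one_or (σ v) with h | h <;> simp [signs, h]

/-- Exchanging the spins off `P` between two independent copies lets one copy serve both functions;
the other copy then only counts configurations. -/
theorem sum_mul_sum_of_local (P : Finset V) (f h : (V → ℤˣ) → ℝ)
    (hf : ∀ σ τ : V → ℤˣ, (∀ v ∈ P, σ v = τ v) → f σ = f τ)
    (hh : ∀ σ τ : V → ℤˣ, (∀ v, v ∉ P → σ v = τ v) → h σ = h τ) :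
    (∑ σ, f σ) * ∑ σ, h σ = (Fintype.card (V → ℤˣ) : ℝ) * ∑ σ, f σ * h σ := by
  let Φ : (V → ℤˣ) × (V → ℤˣ) → (V → ℤˣ) × (V → ℤˣ) := fun p =>
    (P.piecewise p.1 p.2, P.piecewise p.2 p.1)
  have hΦ : Function.Involutive Φ := by
    intro p
    refine Prod.ext (funext fun v => ?_) (funext fun v => ?_) <;>
      by_cases h : v ∈ P <;> simp [Φ, h]
  calc _ = ∑ p : (V → ℤˣ) × (V → ℤˣ), f p.1 * h p.2 := by
        rw [sum_mul_sum, Fintype.sum_prod_type]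
    _ = ∑ p : (V → ℤˣ) × (V → ℤˣ), f (Φ p).1 * h (Φ p).1 := by
        refine sum_congr rfl fun p _ => ?_
        congr 1
        · exact hf _ _ fun v hv => by simp [Φ, hv]
        · exact hh _ _ fun v hv => by simp [Φ, hv]
    _ = ∑ p : (V → ℤˣ) × (V → ℤˣ), f p.1 * h p.1 :=
        Equiv.sum_comp hΦ.toPerm fun p : (V → ℤˣ) × (V → ℤˣ) => f p.1 * h p.1
    _ = _ := by
        rw [Fintype.sum_prod_type]
        simp [← mul_sum]

end Sums

section Cover
variable {V ι : Type*} (a b : ι → V) (tw : ι → Bool)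

/-- First end point of an edge of the double cover. -/
def ca (p : ι × Bool) : V × Bool := (a p.1, p.2)

/-- Second end point of an edge of the double cover with twists `tw`. -/
def cb (p : ι × Bool) : V × Bool := (b p.1, xor p.2 (tw p.1))

/-- All the lifts of the edges in `F`. -/
def lift (F : Finset ι) : Finset (ι × Bool) := F ×ˢ univ

/-- The sign of a twist. -/
def sgn (u : Bool) : ℝ := if u then -1 else 1

theorem sgn_cases (u : Bool) : sgn u = 1 ∨ sgn u = -1 := by cases u <;> simp [sgn]

variable {a b tw}

theorem mem_lift {F : Finset ι} {p : ι × Bool} : p ∈ lift F ↔ p.1 ∈ F := by simp [lift]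

theorem lift_mono {F G : Finset ι} (h : F ⊆ G) : lift F ⊆ lift G := fun _ hp =>
  mem_lift.2 (h (mem_lift.1 hp))

theorem wt_lift (t : ℝ) (F : Finset ι) (σ τ : V → ℤˣ) :
    wt (ca a) (cb b tw) (fun _ => t) (lift F) (pairing σ τ) =
      ∏ i ∈ F, (1 + t * (sp σ (a i) * sp (if tw i then τ else σ) (b i))) *
        (1 + t * (sp τ (a i) * sp (if tw i then σ else τ) (b i))) := by
  unfold wt lift
  rw [prod_product]
  refine prod_congr rfl fun i _ => ?_
  rw [Fintype.prod_bool, mul_comm]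
  cases h : tw i <;> simp [ca, cb, h, sp_pairing_false, sp_pairing_true]

variable [DecidableEq V]

/-- The edges of `F` with both ends in `P`. -/
def inside (a b : ι → V) (F : Finset ι) (P : Finset V) : Finset ι :=
  F.filter fun i => a i ∈ P ∧ b i ∈ P

/-- The weight of the edges of `F` across the boundary of `P`. -/
def cut (a b : ι → V) (t : ℝ) (F : Finset ι) (P : Finset V) : ℝ :=
  ∏ i ∈ F, if (a i ∈ P ↔ b i ∈ P) then 1 + t ^ 2 else 1 - t ^ 2

theorem cut_nonneg {t : ℝ} (ht0 : 0 ≤ t) (ht1 : t < 1) (F : Finset ι) (P : Finset V) :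
    0 ≤ cut a b t F P := by
  refine prod_nonneg fun i _ => ?_
  split_ifs
  · positivity
  · nlinarith

/-- The number of edges across the boundary of a set is submodular, and such edges carry the smaller
weight. -/
theorem cut_mul_le {t : ℝ} (ht0 : 0 ≤ t) (ht1 : t < 1) (F : Finset ι) (P Q : Finset V) :
    cut a b t F P * cut a b t F Q ≤ cut a b t F (P ∩ Q) * cut a b t F (P ∪ Q) := by
  unfold cut
  rw [← prod_mul_distrib, ← prod_mul_distrib]
  have h1 : 0 ≤ 1 - t ^ 2 := by nlinarith
  have h2 : 1 - t ^ 2 ≤ 1 + t ^ 2 := by nlinarith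
  have h3 : 0 ≤ 1 + t ^ 2 := h1.trans h2
  refine prod_le_prod (fun i _ => ?_) fun i _ => ?_
  · refine mul_nonneg ?_ ?_ <;> split_ifs <;> assumption
  · by_cases p1 : a i ∈ P <;> by_cases p2 : b i ∈ P <;> by_cases p3 : a i ∈ Q <;>
      by_cases p4 : b i ∈ Q <;> simp [p1, p2, p3, p4] <;> nlinarith

/-- The two lifts of an edge inside `P` give `(1 + t e)²` with `e = σ_a σ_b`, twisted or not, which
is `(1 + t²)(1 + θ e)` for `θ = 2t / (1 + t²)`. Off `P` the sheets are opposite and a twist reverses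
the sign of `θ`. Across the boundary the product is `(1 + t e)(1 - t e) = 1 - t²`. Hence twists are
visible only off `P`. -/
theorem wt_lift_signs {t : ℝ} (F : Finset ι) (σ : V → ℤˣ) [Fintype V] (P : Finset V) :
    wt (ca a) (cb b tw) (fun _ => t) (lift F) (pairing σ (σ * signs P)) =
      cut a b t F P * (wt a b (fun _ => 2 * t / (1 + t ^ 2)) (inside a b F P) σ *
        wt a b (fun i => 2 * t / (1 + t ^ 2) * sgn (tw i)) (inside a b F Pᶜ) σ) := by
  rw [wt_lift]
  unfold cut wt inside
  rw [prod_filter, prod_filter, ← prod_mul_distrib, ← prod_mul_distrib]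
  refine prod_congr rfl fun i _ => ?_
  have h : (1 + t ^ 2) ≠ 0 := by positivity
  by_cases p1 : a i ∈ P <;> by_cases p2 : b i ∈ P <;> cases hu : tw i <;>
    rcases sp_cases σ (a i) with h1 | h1 <;> rcases sp_cases σ (b i) with h2 | h2 <;>
    simp [p1, p2, hu, sp_mul, sp_signs, sgn, h1, h2] <;> field_simp <;> ring

theorem wt_congr_of_inside (c : ι → ℝ) (F : Finset ι) (P : Finset V) {σ τ : V → ℤˣ}
    (h : ∀ v ∈ P, σ v = τ v) : wt a b c (inside a b F P) σ = wt a b c (inside a b F P) τ := by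
  refine prod_congr rfl fun i hi => ?_
  obtain ⟨_, h1, h2⟩ := mem_filter.1 hi
  simp only [sp, h _ h1, h _ h2]

variable [Fintype V]

theorem theta_bounds {t : ℝ} (ht0 : 0 ≤ t) : 0 ≤ 2 * t / (1 + t ^ 2) ∧ 2 * t / (1 + t ^ 2) ≤ 1 := by
  refine ⟨by positivity, ?_⟩
  rw [div_le_one (by positivity)]
  nlinarith [sq_nonneg (1 - t)]

/-- Sum over the configurations of the cover for which the sheets agree exactly on `P`, with the
spins at `x` and `y`. -/
noncomputable def agreeNum (a b : ι → V) (tw : ι → Bool) (t : ℝ) (F : Finset ι) (x y : V)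
    (P : Finset V) : ℝ :=
  if x ∈ P ∧ y ∈ P then
    cut a b t F P * (num a b (fun _ => 2 * t / (1 + t ^ 2)) (inside a b F P) x y *
      part a b (fun i => 2 * t / (1 + t ^ 2) * sgn (tw i)) (inside a b F Pᶜ))
  else 0

/-- The sum of the two spins above `x` is `2 σ_x` if the sheets agree at `x` and `0` otherwise,
whence the `4`. Given the agreement set, its inside and outside decouple, and the decoupling
produces the number of configurations on the left. -/
theorem sum_agreeNum (t : ℝ) (F : Finset ι) (x y : V) :
    (Fintype.card (V → ℤˣ) : ℝ) * ∑ σ : V × Bool → ℤˣ,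
      (sp σ (x, false) + sp σ (x, true)) * (sp σ (y, false) + sp σ (y, true)) *
        wt (ca a) (cb b tw) (fun _ => t) (lift F) σ = 4 * ∑ P, agreeNum a b tw t F x y P := by
  rw [sum_cover]
  have h : ∀ σ : V → ℤˣ, ∀ f : (V → ℤˣ) → ℝ, ∑ τ, f τ = ∑ P : Finset V, f (σ * signs P) := by
    intro σ f
    rw [← sum_signs fun τ => f (σ * τ)]
    exact (Equiv.sum_comp (Equiv.mulLeft σ) f).symm
  have e : ∀ σ : V → ℤˣ, ∑ τ : V → ℤˣ,
      (sp (pairing σ τ) (x, false) + sp (pairing σ τ) (x, true)) *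
        (sp (pairing σ τ) (y, false) + sp (pairing σ τ) (y, true)) *
        wt (ca a) (cb b tw) (fun _ => t) (lift F) (pairing σ τ) =
      ∑ P : Finset V, if x ∈ P ∧ y ∈ P then 4 * (cut a b t F P * (sp σ x * sp σ y *
        wt a b (fun _ => 2 * t / (1 + t ^ 2)) (inside a b F P) σ *
        wt a b (fun i => 2 * t / (1 + t ^ 2) * sgn (tw i)) (inside a b F Pᶜ) σ)) else 0 := by
    intro σ
    rw [h σ]
    refine sum_congr rfl fun P _ => ?_
    simp only [sp_pairing_false, sp_pairing_true, sp_mul, sp_signs]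
    rw [wt_lift_signs]
    by_cases hx : x ∈ P <;> by_cases hy : y ∈ P <;> simp [hx, hy]
    ring
  simp only [e]
  rw [sum_comm, mul_sum, mul_sum]
  refine sum_congr rfl fun P _ => ?_
  unfold agreeNum
  split_ifs with hP
  · rw [← mul_sum, ← mul_sum]
    unfold num part
    rw [sum_mul_sum_of_local P]
    · ring
    · intro σ τ hστ
      rw [wt_congr_of_inside _ _ _ hστ]
      simp only [sp, hστ x hP.1, hστ y hP.2]
    · intro σ τ hστ
      exact wt_congr_of_inside _ _ _ fun v hv => hστ v (mem_compl.1 hv)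
  · simp

theorem agreeNum_nonneg {t : ℝ} (ht0 : 0 ≤ t) (ht1 : t < 1) (F : Finset ι) (x y : V)
    (P : Finset V) : 0 ≤ agreeNum a b tw t F x y P := by
  unfold agreeNum
  obtain ⟨h0, h1⟩ := theta_bounds ht0
  split_ifs
  · refine mul_nonneg (cut_nonneg ht0 ht1 F P) (mul_nonneg (num_nonneg (fun _ => h0) _ _ _)
      (part_nonneg (fun i => ?_) _))
    rcases sgn_cases (tw i) with h | h <;> rw [h, abs_le] <;> constructor <;> linarith
  · exact le_rfl

omit [DecidableEq V] in
theorem cone_wt_sub_one {c : ι → ℝ} (hc : ∀ i, 0 ≤ c i) (F : Finset ι) :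
    Cone fun σ : V → ℤˣ => wt a b c F σ - 1 := by
  classical
  induction F using Finset.induction_on with
  | empty => simpa [wt] using Cone.const (V := V) le_rfl
  | insert i F hi ih =>
    refine cast (congrArg Cone (funext fun σ => ?_)) (Cone.add _ _ ih
      (((Cone.const (hc i)).mul ((Cone.spin (a i)).mul (Cone.spin (b i)))).mul
        (cone_wt (a := a) (b := b) hc F)))
    unfold wt
    rw [prod_insert hi]
    ring

theorem num_mono {c : ι → ℝ} (hc : ∀ i, 0 ≤ c i) {F G : Finset ι} (h : F ⊆ G) (x y : V) :
    num a b c F x y ≤ num a b c G x y := by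
  classical
  have e : num a b c G x y = num a b c F x y +
      ∑ σ : V → ℤˣ, sp σ x * sp σ y * wt a b c F σ * (wt a b c (G \ F) σ - 1) := by
    unfold num
    rw [← sum_add_distrib]
    refine sum_congr rfl fun σ _ => ?_
    have : wt a b c G σ = wt a b c (G \ F) σ * wt a b c F σ := (prod_sdiff h).symm
    rw [this]
    ring
  rw [e]
  exact le_add_of_nonneg_right ((((Cone.spin x).mul (Cone.spin y)).mul (cone_wt hc F)).mul
    (cone_wt_sub_one hc _)).sum_nonneg

omit [Fintype V] in
theorem inside_inter [DecidableEq ι] (F : Finset ι) (P Q : Finset V) :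
    inside a b F P ∩ inside a b F Q = inside a b F (P ∩ Q) := by
  ext i; simp only [inside, mem_inter, mem_filter]; tauto

omit [Fintype V] in
theorem inside_union_subset [DecidableEq ι] (F : Finset ι) (P Q : Finset V) :
    inside a b F P ∪ inside a b F Q ⊆ inside a b F (P ∪ Q) := by
  intro i; simp only [inside, mem_union, mem_filter]; tauto

/-- The hypothesis of the four functions theorem for the comparison of the trivial cover with the
twisted one. -/
theorem agreeNum_mul_le {t : ℝ} (ht0 : 0 ≤ t) (ht1 : t < 1) (F : Finset ι) (x y : V)
    (P Q : Finset V) :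
    agreeNum a b (fun _ => false) t F x y P * agreeNum a b tw t F y y Q ≤
      agreeNum a b (fun _ => false) t F y y (P ∩ Q) * agreeNum a b tw t F x y (P ∪ Q) := by
  classical
  by_cases h : (x ∈ P ∧ y ∈ P) ∧ y ∈ Q
  swap
  · have : agreeNum a b (fun _ => false) t F x y P * agreeNum a b tw t F y y Q = 0 := by
      unfold agreeNum
      by_cases h1 : x ∈ P ∧ y ∈ P
      · have : y ∉ Q := fun h2 => h ⟨h1, h2⟩
        simp [this]
      · rw [if_neg h1, zero_mul]
    rw [this]
    exact mul_nonneg (agreeNum_nonneg ht0 ht1 _ _ _ _) (agreeNum_nonneg ht0 ht1 _ _ _ _)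
  obtain ⟨⟨hx, hy⟩, hyQ⟩ := h
  unfold agreeNum
  rw [if_pos ⟨hx, hy⟩, if_pos ⟨hyQ, hyQ⟩,
    if_pos ⟨mem_inter.2 ⟨hy, hyQ⟩, mem_inter.2 ⟨hy, hyQ⟩⟩,
    if_pos ⟨mem_union_left _ hx, mem_union_left _ hy⟩]
  obtain ⟨h0, h1⟩ := theta_bounds ht0
  set θ := 2 * t / (1 + t ^ 2) with hθ
  have hs : ∀ i, |θ * sgn (tw i)| ≤ 1 := fun i => by
    rcases sgn_cases (tw i) with h | h <;> rw [h, abs_le] <;> constructor <;> linarith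
  have e : (fun _ : ι => θ * sgn false) = fun _ => θ := by simp [sgn]
  simp only [e, num_self]
  have i1 : num a b (fun _ => θ) (inside a b F P) x y * part a b (fun _ => θ) (inside a b F Q) ≤
      num a b (fun _ => θ) (inside a b F (P ∪ Q)) x y *
        part a b (fun _ => θ) (inside a b F (P ∩ Q)) := by
    have := num_mul_part_le (a := a) (b := b) (c := fun _ => θ) (fun _ => h0) (fun _ => h1)
      (s := fun _ => 1) (fun _ => Or.inl rfl) (inside a b F P) (inside a b F Q) x y
    simp only [mul_one, inside_inter] at this
    refine this.trans (mul_le_mul_of_nonneg_right (num_mono (fun _ => h0)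
      (inside_union_subset F P Q) x y) (part_nonneg (fun _ => ?_) _))
    rw [abs_of_nonneg h0]; exact h1
  -- Outside the agreement sets the ferromagnetic system meets the one with twist signs. This is
  -- Ginibre's inequality with signs, applied with equal end points so that the numerators are
  -- partition functions.
  have i2 : part a b (fun _ => θ) (inside a b F Pᶜ) *
      part a b (fun i => θ * sgn (tw i)) (inside a b F Qᶜ) ≤
      part a b (fun _ => θ) (inside a b F (P ∩ Q)ᶜ) *
      part a b (fun i => θ * sgn (tw i)) (inside a b F (P ∪ Q)ᶜ) := by
    have := num_mul_part_le (a := a) (b := b) (c := fun _ => θ) (fun _ => h0) (fun _ => h1)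
      (s := fun i => sgn (tw i)) (fun i => sgn_cases _) (inside a b F Pᶜ) (inside a b F Qᶜ) x x
    simp only [num_self, inside_inter] at this
    rw [compl_inter, compl_union]
    refine this.trans (mul_le_mul_of_nonneg_right ?_ (part_nonneg hs _))
    have m := num_mono (a := a) (b := b) (c := fun _ => θ) (fun _ => h0)
      (inside_union_subset (a := a) (b := b) F Pᶜ Qᶜ) x x
    rwa [num_self, num_self] at m
  have i3 := cut_mul_le (a := a) (b := b) ht0 ht1 F P Q
  have hθ' : ∀ _ : ι, |θ| ≤ 1 := fun _ => by rw [abs_of_nonneg h0]; exact h1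
  calc _ = (cut a b t F P * cut a b t F Q) *
        ((num a b (fun _ => θ) (inside a b F P) x y * part a b (fun _ => θ) (inside a b F Q)) *
        (part a b (fun _ => θ) (inside a b F Pᶜ) *
          part a b (fun i => θ * sgn (tw i)) (inside a b F Qᶜ))) := by ring
    _ ≤ (cut a b t F (P ∩ Q) * cut a b t F (P ∪ Q)) *
        ((num a b (fun _ => θ) (inside a b F (P ∪ Q)) x y *
          part a b (fun _ => θ) (inside a b F (P ∩ Q))) *
        (part a b (fun _ => θ) (inside a b F (P ∩ Q)ᶜ) *
          part a b (fun i => θ * sgn (tw i)) (inside a b F (P ∪ Q)ᶜ))) := by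
        refine mul_le_mul i3 (mul_le_mul i1 i2 ?_ ?_) ?_ ?_
        · exact mul_nonneg (part_nonneg hθ' _) (part_nonneg hs _)
        · exact mul_nonneg (num_nonneg (fun _ => h0) _ _ _) (part_nonneg hθ' _)
        · exact mul_nonneg (mul_nonneg (num_nonneg (fun _ => h0) _ _ _) (part_nonneg hθ' _))
            (mul_nonneg (part_nonneg hθ' _) (part_nonneg hs _))
        · exact mul_nonneg (cut_nonneg ht0 ht1 _ _) (cut_nonneg ht0 ht1 _ _)
    _ = _ := by ring

theorem sum_sp_mul_wt (c : ι → ℝ) (F : Finset ι) (x : V) :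
    ∑ σ : V → ℤˣ, sp σ x * wt a b c F σ = 0 := by
  have h : ∑ σ : V → ℤˣ, sp σ x * wt a b c F σ = -∑ σ : V → ℤˣ, sp σ x * wt a b c F σ := by
    conv_lhs => rw [← Equiv.sum_comp (Equiv.mulLeft (-1 : V → ℤˣ))]
    rw [← sum_neg_distrib]
    refine sum_congr rfl fun σ _ => ?_
    have hn : ∀ z, sp (-1 : V → ℤˣ) z = -1 := fun z => by simp [sp]
    have hw : wt a b c F (-1 * σ) = wt a b c F σ := by
      refine prod_congr rfl fun i _ => ?_
      rw [sp_mul, sp_mul, hn, hn]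
      ring
    rw [Equiv.coe_mulLeft, hw, sp_mul, hn]
    ring
  linarith

/-- On the trivial cover the two sheets are independent. -/
theorem sum_trivial_cover (t : ℝ) (F : Finset ι) (x y : V) :
    ∑ σ : V × Bool → ℤˣ,
      (sp σ (x, false) + sp σ (x, true)) * (sp σ (y, false) + sp σ (y, true)) *
        wt (ca a) (cb b fun _ => false) (fun _ => t) (lift F) σ =
      2 * (num a b (fun _ => t) F x y * part a b (fun _ => t) F) := by
  rw [sum_cover]
  have e : ∀ σ τ : V → ℤˣ, wt (ca a) (cb b fun _ => false) (fun _ => t) (lift F) (pairing σ τ) =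
      wt a b (fun _ => t) F σ * wt a b (fun _ => t) F τ := by
    intro σ τ
    rw [wt_lift]
    simp [wt, prod_mul_distrib]
  simp only [sp_pairing_false, sp_pairing_true, e]
  have z1 := sum_sp_mul_wt (a := a) (b := b) (fun _ => t) F x
  have z2 := sum_sp_mul_wt (a := a) (b := b) (fun _ => t) F y
  calc _ = ∑ σ : V → ℤˣ, ∑ τ : V → ℤˣ,
        (sp σ x * sp σ y * wt a b (fun _ => t) F σ * wt a b (fun _ => t) F τ +
        wt a b (fun _ => t) F σ * (sp τ x * sp τ y * wt a b (fun _ => t) F τ) +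
        (sp σ x * wt a b (fun _ => t) F σ * (sp τ y * wt a b (fun _ => t) F τ) +
        sp σ y * wt a b (fun _ => t) F σ * (sp τ x * wt a b (fun _ => t) F τ))) :=
      sum_congr rfl fun σ _ => sum_congr rfl fun τ _ => by ring
    _ = _ := by
      simp only [sum_add_distrib, ← sum_mul_sum, z1, z2]
      unfold num part
      ring

/-- Deck transformation. -/
theorem corr_deck (t : ℝ) (F : Finset ι) (x y : V) (u v : Bool) :
    corr (ca a) (cb b tw) t (lift F) (x, !u) (y, !v) =
      corr (ca a) (cb b tw) t (lift F) (x, u) (y, v) := by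
  classical
  have hφ : Function.Injective fun p : V × Bool => (p.1, !p.2) := by
    rintro ⟨v, u⟩ ⟨v', u'⟩ h
    simpa using h
  have hj : Set.InjOn (fun p : ι × Bool => (p.1, !p.2)) (lift F : Finset (ι × Bool)) := by
    rintro ⟨v, u⟩ _ ⟨v', u'⟩ _ h
    simpa using h
  have hI : (lift F).image (fun p : ι × Bool => (p.1, !p.2)) = lift F := by
    ext ⟨i, u⟩
    simp only [mem_image, mem_lift]
    constructor
    · rintro ⟨p, hp, h⟩
      obtain ⟨rfl, -⟩ := Prod.mk.inj h; exact hp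
    · intro h
      exact ⟨(i, !u), h, by simp⟩
  have := corr_embed (a := ca a) (b := cb b tw) (a' := ca a) (b' := cb b tw) hφ hj
    (fun p _ => Or.inl ⟨rfl, by simp [cb]⟩) t (x, u) (y, v)
  rwa [hI] at this

/-- The torus-type sum of the correlations of the cover over the two lifts of `y`. -/
noncomputable def corr₂ (a b : ι → V) (tw : ι → Bool) (t : ℝ) (F : Finset ι) (x y : V) : ℝ :=
  corr (ca a) (cb b tw) t (lift F) (x, false) (y, false) +
    corr (ca a) (cb b tw) t (lift F) (x, false) (y, true)

/-- The correlation of the two lifts of `y`. -/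
noncomputable def loop (a b : ι → V) (tw : ι → Bool) (t : ℝ) (F : Finset ι) (y : V) : ℝ :=
  corr (ca a) (cb b tw) t (lift F) (y, false) (y, true)

theorem corr₂_eq (t : ℝ) (F : Finset ι) (x y : V) (u v : Bool) :
    corr (ca a) (cb b tw) t (lift F) (x, u) (y, v) +
      corr (ca a) (cb b tw) t (lift F) (x, u) (y, !v) = corr₂ a b tw t F x y := by
  unfold corr₂
  have h1 := corr_deck (a := a) (b := b) (tw := tw) t F x y false false
  have h2 := corr_deck (a := a) (b := b) (tw := tw) t F x y false true
  simp only [Bool.not_false, Bool.not_true] at h1 h2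
  cases u <;> cases v <;> simp only [Bool.not_false, Bool.not_true] <;> linarith

theorem loop_eq (t : ℝ) (F : Finset ι) (y : V) (u : Bool) :
    corr (ca a) (cb b tw) t (lift F) (y, u) (y, !u) = loop a b tw t F y := by
  unfold loop
  cases u
  · rfl
  · exact corr_comm _ _ _ _

theorem sum_cover_eq {t : ℝ} (ht0 : 0 ≤ t) (ht1 : t < 1) (F : Finset ι) (x y : V) :
    ∑ σ : V × Bool → ℤˣ,
      (sp σ (x, false) + sp σ (x, true)) * (sp σ (y, false) + sp σ (y, true)) *
        wt (ca a) (cb b tw) (fun _ => t) (lift F) σ =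
      2 * corr₂ a b tw t F x y * part (ca a) (cb b tw) (fun _ => t) (lift F) := by
  have p := corr_part_pos (a := ca a) (b := cb b tw) ht0 ht1 (lift F)
  have h : ∀ w z, num (ca a) (cb b tw) (fun _ => t) (lift F) w z =
      corr (ca a) (cb b tw) t (lift F) w z * part (ca a) (cb b tw) (fun _ => t) (lift F) := by
    intro w z; unfold corr; field_simp
  calc _ = num (ca a) (cb b tw) (fun _ => t) (lift F) (x, false) (y, false) +
        num (ca a) (cb b tw) (fun _ => t) (lift F) (x, false) (y, true) +
        (num (ca a) (cb b tw) (fun _ => t) (lift F) (x, true) (y, false) +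
        num (ca a) (cb b tw) (fun _ => t) (lift F) (x, true) (y, true)) := by
        unfold num
        simp only [← sum_add_distrib]
        exact sum_congr rfl fun σ _ => by ring
    _ = _ := by
      simp only [h]
      have h1 := corr₂_eq (a := a) (b := b) (tw := tw) t F x y false false
      have h2 := corr₂_eq (a := a) (b := b) (tw := tw) t F x y true false
      simp only [Bool.not_false] at h1 h2
      linear_combination (part (ca a) (cb b tw) (fun _ => t) (lift F)) * (h1 + h2)

theorem corr₂_self {t : ℝ} (ht0 : 0 ≤ t) (ht1 : t < 1) (F : Finset ι) (y : V) :
    corr₂ a b tw t F y y = 1 + loop a b tw t F y := by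
  unfold corr₂ loop
  rw [corr_self ht0 ht1]

/-- Passing to a double cover increases the correlations, summed over the lifts, by at least the
factor `1 + loop`. -/
theorem corr_mul_le_corr₂ {t : ℝ} (ht0 : 0 ≤ t) (ht1 : t < 1) (F : Finset ι) (x y : V) :
    corr a b t F x y * (1 + loop a b tw t F y) ≤ corr₂ a b tw t F x y := by
  -- The four sums are, up to common factors, `corr`, `1 + loop`, `1` and `corr₂`: on the trivial
  -- cover the sheets are independent, so it returns the base model.
  have h := four_functions_theorem_univ (agreeNum a b (fun _ => false) t F x y)
    (agreeNum a b tw t F y y) (agreeNum a b (fun _ => false) t F y y) (agreeNum a b tw t F x y)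
    (fun P => agreeNum_nonneg ht0 ht1 _ _ _ P) (fun P => agreeNum_nonneg ht0 ht1 _ _ _ P)
    (fun P => agreeNum_nonneg ht0 ht1 _ _ _ P) (fun P => agreeNum_nonneg ht0 ht1 _ _ _ P)
    (agreeNum_mul_le ht0 ht1 F x y)
  have hN : (0 : ℝ) < Fintype.card (V → ℤˣ) := by exact_mod_cast Fintype.card_pos
  have s1 := sum_agreeNum (a := a) (b := b) (tw := fun _ => false) t F x y
  have s2 := sum_agreeNum (a := a) (b := b) (tw := tw) t F y y
  have s3 := sum_agreeNum (a := a) (b := b) (tw := fun _ => false) t F y y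
  have s4 := sum_agreeNum (a := a) (b := b) (tw := tw) t F x y
  rw [sum_trivial_cover] at s1 s3
  rw [sum_cover_eq ht0 ht1] at s2 s4
  rw [num_self] at s3
  rw [corr₂_self ht0 ht1] at s2
  have p1 := corr_part_pos (a := a) (b := b) ht0 ht1 F
  have p2 := corr_part_pos (a := ca a) (b := cb b tw) ht0 ht1 (lift F)
  have e : num a b (fun _ => t) F x y = corr a b t F x y * part a b (fun _ => t) F := by
    unfold corr; field_simp
  rw [e] at s1
  set N : ℝ := (Fintype.card (V → ℤˣ) : ℝ)
  set Z := part a b (fun _ => t) F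
  set Z' := part (ca a) (cb b tw) (fun _ => t) (lift F)
  have h' : (4 * ∑ P, agreeNum a b (fun _ => false) t F x y P) *
      (4 * ∑ P, agreeNum a b tw t F y y P) ≤
      (4 * ∑ P, agreeNum a b (fun _ => false) t F y y P) *
      (4 * ∑ P, agreeNum a b tw t F x y P) := by nlinarith
  rw [← s1, ← s2, ← s3, ← s4] at h'
  have q : 0 < 4 * N ^ 2 * Z ^ 2 * Z' := by positivity
  refine le_of_mul_le_mul_left ?_ q
  nlinarith [h']

end Cover

end IsingCover

/-! ### Explorations: the upper bound for a double cover, and Lieb's inequality. -/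

namespace IsingCover

open Finset

section Exploration
variable {V ι : Type*} {a b : ι → V} {tw : ι → Bool}

/-- The other point of the same fibre. -/
def other {α : Type*} (p : α × Bool) : α × Bool := (p.1, !p.2)

theorem other_other {α : Type*} (p : α × Bool) : other (other p) = p := by simp [other]

theorem other_ne {α : Type*} (p : α × Bool) : other p ≠ p := by
  intro h
  have := congrArg Prod.snd h
  simp [other] at this

theorem eq_other {α : Type*} {p q : α × Bool} (h : q.1 = p.1) (hne : q ≠ p) : q = other p := by
  obtain ⟨x, u⟩ := p
  obtain ⟨y, v⟩ := q
  simp only at h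
  subst h
  cases u <;> cases v <;> simp [other] at hne ⊢

theorem Joins.fst {e : ι × Bool} {p q : V × Bool} (h : Joins (ca a) (cb b tw) e p q) :
    Joins a b e.1 p.1 q.1 := by
  rcases h with ⟨rfl, rfl⟩ | ⟨rfl, rfl⟩
  · exact Or.inl ⟨rfl, rfl⟩
  · exact Or.inr ⟨rfl, rfl⟩

theorem Joins.other {e : ι × Bool} {p q : V × Bool} (h : Joins (ca a) (cb b tw) e p q) :
    Joins (ca a) (cb b tw) (other e) (other p) (other q) := by
  rcases h with ⟨rfl, rfl⟩ | ⟨rfl, rfl⟩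
  · exact Or.inl ⟨rfl, by simp [IsingCover.other, cb]⟩
  · exact Or.inr ⟨rfl, by simp [IsingCover.other, cb]⟩

theorem exists_lift_edge {i : ι} {p : V × Bool} (h : a i = p.1 ∨ b i = p.1) :
    ∃ u, ca a (i, u) = p ∨ cb b tw (i, u) = p := by
  obtain ⟨x, u⟩ := p
  rcases h with rfl | rfl
  · exact ⟨u, Or.inl rfl⟩
  · exact ⟨xor u (tw i), Or.inr (by simp [cb])⟩

variable [Fintype V] [DecidableEq V]

theorem loop_mono {t : ℝ} (ht0 : 0 ≤ t) (ht1 : t < 1) {E F : Finset ι} (h : E ⊆ F) (y : V) :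
    loop a b tw t E y ≤ loop a b tw t F y :=
  corr_mono ht0 ht1 (lift_mono h) _ _

theorem loop_nonneg {t : ℝ} (ht0 : 0 ≤ t) (ht1 : t < 1) (F : Finset ι) (y : V) :
    0 ≤ loop a b tw t F y :=
  corr_nonneg ht0 ht1 _ _ _

theorem corr₂_nonneg {t : ℝ} (ht0 : 0 ≤ t) (ht1 : t < 1) (F : Finset ι) (x y : V) :
    0 ≤ corr₂ a b tw t F x y :=
  add_nonneg (corr_nonneg ht0 ht1 _ _ _) (corr_nonneg ht0 ht1 _ _ _)

theorem corr_le_corr₂ {t : ℝ} (ht0 : 0 ≤ t) (ht1 : t < 1) (F : Finset ι) (x y : V) :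
    corr a b t F x y ≤ corr₂ a b tw t F x y := by
  refine le_trans ?_ (corr_mul_le_corr₂ ht0 ht1 F x y)
  exact le_mul_of_one_le_right (corr_nonneg ht0 ht1 _ _ _)
    (le_add_of_nonneg_right (loop_nonneg ht0 ht1 F y))

variable [DecidableEq ι]

/-- The increase of the loop function when an edge is added to the base graph. -/
theorem le_loop_sub_loop {t : ℝ} (ht0 : 0 ≤ t) (ht1 : t < 1) {E : Finset ι}
    {K : Finset (ι × Bool)} {e : ι × Bool} (he : e.1 ∈ E) (hK : lift (E.erase e.1) ⊆ K)
    {p q : V × Bool} (hJ : Joins (ca a) (cb b tw) e p q) :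
    (1 + t * corr (ca a) (cb b tw) t K p q)⁻¹ * (t * (corr a b t (E.erase e.1) p.1 q.1 -
      corr (ca a) (cb b tw) t K p q)) ≤
      loop a b tw t E p.1 - loop a b tw t (E.erase e.1) p.1 := by
  set κ := corr (ca a) (cb b tw) t K p q with hκ
  set τ := corr a b t (E.erase e.1) p.1 q.1 with hτ
  have hκ0 : 0 ≤ κ := corr_nonneg ht0 ht1 _ _ _
  have hmono : loop a b tw t (E.erase e.1) p.1 ≤ loop a b tw t E p.1 :=
    loop_mono ht0 ht1 (erase_subset _ _) _
  rcases le_total τ κ with h | h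
  · refine le_trans (mul_nonpos_of_nonneg_of_nonpos (by positivity) ?_) (sub_nonneg.2 hmono)
    exact mul_nonpos_of_nonneg_of_nonpos ht0 (by linarith)
  set G := lift (E.erase e.1) with hG
  have heG : e ∉ G := by simp [hG, mem_lift]
  have hsub : insert e G ⊆ lift E := by
    refine insert_subset (mem_lift.2 he) (lift_mono (erase_subset _ _))
  have h1 : corr (ca a) (cb b tw) t (insert e G) p (other p) ≤ loop a b tw t E p.1 := by
    rw [← loop_eq t E p.1 p.2]
    exact corr_mono ht0 ht1 hsub _ _
  have hX : corr (ca a) (cb b tw) t G p (other p) = loop a b tw t (E.erase e.1) p.1 :=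
    loop_eq t (E.erase e.1) p.1 p.2
  have h2 := corr_insert_mul ht0 ht1 heG hJ (other p)
  rw [hX] at h2
  -- The lower bound for covers gives `γ ≥ τ (1 + X) - α`, hence `γ - α X ≥ (τ - α)(1 + X) ≥ τ - κ`,
  -- using `α ≤ κ ≤ τ`.
  have h3 := corr_mul_le_corr₂ (a := a) (b := b) (tw := tw) ht0 ht1 (E.erase e.1) q.1 p.1
  rw [← corr₂_eq t (E.erase e.1) q.1 p.1 q.2 p.2, corr_comm t (E.erase e.1) q.1 p.1] at h3
  change τ * _ ≤ corr (ca a) (cb b tw) t G q p + corr (ca a) (cb b tw) t G q (other p) at h3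
  rw [corr_comm t G q p] at h3
  set X := loop a b tw t (E.erase e.1) p.1
  have hX0 : 0 ≤ X := loop_nonneg ht0 ht1 _ _
  set α := corr (ca a) (cb b tw) t G p q
  have hα : α ≤ κ := corr_mono ht0 ht1 hK _ _
  have hα0 : 0 ≤ α := corr_nonneg ht0 ht1 _ _ _
  set γ := corr (ca a) (cb b tw) t G q (other p)
  set L := corr (ca a) (cb b tw) t (insert e G) p (other p)
  refine le_trans ?_ (sub_le_sub_right h1 X)
  have pα : 0 < 1 + t * α := by positivity
  have pκ : 0 < 1 + t * κ := by positivity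
  have h4 : (L - X) * (1 + t * α) = t * (γ - α * X) := by linarith
  have h5 : t * (τ - κ) ≤ t * (γ - α * X) := by
    refine mul_le_mul_of_nonneg_left ?_ ht0
    nlinarith
  have h6 : 0 ≤ t * (τ - κ) := mul_nonneg ht0 (by linarith)
  have h7 : 1 + t * α ≤ 1 + t * κ := by nlinarith
  calc (1 + t * κ)⁻¹ * (t * (τ - κ)) ≤ (1 + t * α)⁻¹ * (t * (τ - κ)) :=
        mul_le_mul_of_nonneg_right (inv_anti₀ pα h7) h6
    _ ≤ (1 + t * α)⁻¹ * ((L - X) * (1 + t * α)) := by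
        rw [h4]; exact mul_le_mul_of_nonneg_left h5 (by positivity)
    _ = L - X := by field_simp

/-- The weight of a point in the error bound, when the points of `S` have been visited. -/
noncomputable def visitWeight (X : V → ℝ) (S : Finset (V × Bool)) (q : V × Bool) : ℝ :=
  if other q ∈ S then 1 else if q ∈ S then 0 else X q.1

omit [Fintype V] in
theorem visitWeight_nonneg {X : V → ℝ} (hX : ∀ z, 0 ≤ X z) (S : Finset (V × Bool)) (q : V × Bool) :
    0 ≤ visitWeight X S q := by
  unfold visitWeight; split_ifs
  · exact zero_le_one
  · exact le_rfl
  · exact hX _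

-- Visiting `q` lowers its weight from `X` to `0`, which saves `X` as its self-correlation is `1`.
-- It raises the weight of the opposite point from `X` to `1`, which costs at most `κ (1 - X)`,
-- where `κ ≤ X` is the correlation of the two points. Thus a new point can be recorded at no net
-- cost.
omit [DecidableEq ι] in
theorem visitWeight_insert_le {t : ℝ} (ht0 : 0 ≤ t) (ht1 : t < 1) {F : Finset ι}
    {K : Finset (ι × Bool)} (hK : K ⊆ lift F) {S : Finset (V × Bool)} {q : V × Bool}
    (hq : other q ∉ S) {Y w : V → ℝ} (hw : ∀ z, 0 ≤ w z) :
    ∑ z, corr (ca a) (cb b tw) t K q z *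
        (visitWeight (loop a b tw t F) (insert q S) z + Y z.1) * w z.1 ≤
      ∑ z, corr (ca a) (cb b tw) t K q z *
        (visitWeight (loop a b tw t F) S z + Y z.1) * w z.1 := by
  by_cases hqS : q ∈ S
  · rw [insert_eq_of_mem hqS]
  set X := loop a b tw t F with hX
  rw [← sub_nonneg, ← sum_sub_distrib]
  have hsplit : ∀ z ∉ ({q, other q} : Finset (V × Bool)),
      visitWeight X (insert q S) z = visitWeight X S z := by
    intro z hz
    simp only [mem_insert, mem_singleton, not_or] at hz
    have h1 : other z ≠ q := fun h => hz.2 (by rw [← h, other_other])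
    simp [visitWeight, mem_insert, hz.1, h1]
  rw [← sum_subset (subset_univ ({q, other q} : Finset (V × Bool)))]
  · rw [sum_pair (other_ne q).symm]
    have c1 : visitWeight X (insert q S) q = 0 := by
      simp [visitWeight, mem_insert, hq, other_ne]
    have c2 : visitWeight X S q = X q.1 := by simp [visitWeight, hq, hqS]
    have c3 : visitWeight X (insert q S) (other q) = 1 := by
      simp [visitWeight, other_other]
    have c4 : visitWeight X S (other q) = X q.1 := by
      simp [visitWeight, other_other, hq, hqS]; rfl
    rw [c1, c2, c3, c4, corr_self ht0 ht1]
    have h0 : 0 ≤ corr (ca a) (cb b tw) t K q (other q) := corr_nonneg ht0 ht1 _ _ _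
    have h1 : corr (ca a) (cb b tw) t K q (other q) ≤ X q.1 := by
      rw [hX, ← loop_eq t F q.1 q.2]
      exact corr_mono ht0 ht1 hK _ _
    have hw' : w (other q).1 = w q.1 := rfl
    have hY' : Y (other q).1 = Y q.1 := rfl
    rw [hw', hY']
    have hX0 : 0 ≤ X q.1 := loop_nonneg ht0 ht1 _ _
    have : 0 ≤ (X q.1 - corr (ca a) (cb b tw) t K q (other q) * (1 - X q.1)) * w q.1 :=
      mul_nonneg (by nlinarith) (hw _)
    linarith
  · intro z _ hz
    rw [hsplit z hz, sub_self]

/-- Comparison of the correlations of the cover and of the base along an exploration: `E` and `K`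
are the unexplored edges of the base and of the cover, `p` is the current point and `S` the set of
visited points. -/
theorem exploration_bound {t : ℝ} (ht0 : 0 ≤ t) (ht1 : t < 1) (F : Finset ι) (x : V)
    (n : ℕ) (K : Finset (ι × Bool)) (hn : K.card = n) (E : Finset ι) (hEK : lift E ⊆ K)
    (hKF : K ⊆ lift F) (S : Finset (V × Bool)) (p : V × Bool) (hp : p ∈ S) (hp' : other p ∉ S)
    (hinv : ∀ e ∈ K, e.1 ∉ E → other (ca a e) ∈ S ∨ other (cb b tw e) ∈ S) :
    corr (ca a) (cb b tw) t K p (x, false) + corr (ca a) (cb b tw) t K p (x, true) -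
        corr a b t E p.1 x ≤
      ∑ z, corr (ca a) (cb b tw) t K p z *
        (visitWeight (loop a b tw t F) S z + loop a b tw t E z.1) * corr₂ a b tw t F z.1 x := by
  -- Each step removes an edge of the cover at `p`, and its projection from the base if still there.
  -- `hinv` says that a remaining cover edge without base counterpart has an end point opposite to a
  -- visited point.
  induction n using Nat.strong_induction_on generalizing K E S p with
  | _ n ih =>
  have hT0 : ∀ z, 0 ≤ corr₂ a b tw t F z x := fun z => corr₂_nonneg ht0 ht1 F z x
  have hterm : ∀ (K : Finset (ι × Bool)) (E : Finset ι) (S : Finset (V × Bool)) (p z : V × Bool),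
      0 ≤ corr (ca a) (cb b tw) t K p z *
        (visitWeight (loop a b tw t F) S z + loop a b tw t E z.1) * corr₂ a b tw t F z.1 x :=
    fun K E S p z => mul_nonneg (mul_nonneg (corr_nonneg ht0 ht1 _ _ _)
      (add_nonneg (visitWeight_nonneg (fun z => loop_nonneg ht0 ht1 F z) _ _)
        (loop_nonneg ht0 ht1 E _))) (hT0 _)
  -- Once the exploration stands opposite to a visited point the comparison with the base is
  -- abandoned: the term `z = q`, of weight at least `1`, pays for the whole correlation on the
  -- cover.
  have hbail : ∀ (K : Finset (ι × Bool)), K ⊆ lift F → ∀ (E : Finset ι) (q : V × Bool), other q ∈ S →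
      corr (ca a) (cb b tw) t K q (x, false) + corr (ca a) (cb b tw) t K q (x, true) ≤
      ∑ z, corr (ca a) (cb b tw) t K q z *
        (visitWeight (loop a b tw t F) S z + loop a b tw t E z.1) * corr₂ a b tw t F z.1 x := by
    intro K hKF E q hq
    refine le_trans ?_ (single_le_sum (fun z _ => hterm K E S q z) (mem_univ q))
    rw [corr_self ht0 ht1, one_mul]
    have hv : visitWeight (loop a b tw t F) S q = 1 := by simp [visitWeight, hq]
    rw [hv]
    have h1 : corr (ca a) (cb b tw) t K q (x, false) + corr (ca a) (cb b tw) t K q (x, true) ≤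
        corr₂ a b tw t F q.1 x := by
      rw [← corr₂_eq t F q.1 x q.2 false]
      exact add_le_add (corr_mono ht0 ht1 hKF _ _) (corr_mono ht0 ht1 hKF _ _)
    have := loop_nonneg (a := a) (b := b) (tw := tw) ht0 ht1 E q.1
    nlinarith [hT0 q.1]
  by_cases hex : ∃ e ∈ K, ca a e = p ∨ cb b tw e = p
  swap
  · push Not at hex
    have hE : ∀ i ∈ E, a i ≠ p.1 ∧ b i ≠ p.1 := by
      intro i hi
      rw [← not_or]
      intro h
      obtain ⟨u, hu⟩ := exists_lift_edge (tw := tw) h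
      have := hex (i, u) (hEK (mem_lift.2 hi))
      tauto
    rw [corr_eq_of_isolated ht0 ht1 hex, corr_eq_of_isolated ht0 ht1 hex,
      corr_eq_of_isolated ht0 ht1 hE]
    refine le_trans (le_of_eq ?_) (sum_nonneg fun z _ => hterm K E S p z)
    obtain ⟨y, u⟩ := p
    by_cases hyx : y = x <;> cases u <;> simp [hyx]
  obtain ⟨e, heK, he⟩ := hex
  obtain ⟨q, hJ⟩ : ∃ q, Joins (ca a) (cb b tw) e p q := by
    rcases he with h | h
    · exact ⟨_, Or.inl ⟨h, rfl⟩⟩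
    · exact ⟨_, Or.inr ⟨rfl, h⟩⟩
  have hcard : (K.erase e).card < n := by rw [← hn]; exact card_erase_lt_of_mem heK
  have hEK' : lift (E.erase e.1) ⊆ K.erase e := by
    intro f hf
    rw [mem_lift, mem_erase] at hf
    exact mem_erase.2 ⟨fun h => hf.1 (by rw [h]), hEK (mem_lift.2 hf.2)⟩
  have hKF' : K.erase e ⊆ lift F := (erase_subset _ _).trans hKF
  -- The only newly unmatched edge is the second lift of `e`. It ends at `other p`, whose opposite
  -- point `p` has been visited.
  have hinv' : ∀ f ∈ K.erase e, f.1 ∉ E.erase e.1 →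
      other (ca a f) ∈ S ∨ other (cb b tw f) ∈ S := by
    intro f hf hfE
    obtain ⟨hfe, hfK⟩ := mem_erase.1 hf
    by_cases h : f.1 ∈ E
    · have h1 : f.1 = e.1 := by
        by_contra hne
        exact hfE (mem_erase.2 ⟨hne, h⟩)
      have h2 : f = other e := eq_other h1 hfe
      have h3 := hJ.other
      rw [← h2] at h3
      rcases h3 with ⟨h3, -⟩ | ⟨-, h3⟩
      · exact Or.inl (by rw [h3, other_other]; exact hp)
      · exact Or.inr (by rw [h3, other_other]; exact hp)
    · exact hinv f hfK h
  have hB1 := ih _ hcard (K.erase e) rfl (E.erase e.1) hEK' hKF' S p hp hp' hinv'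
  have hB2 : corr (ca a) (cb b tw) t (K.erase e) q (x, false) +
      corr (ca a) (cb b tw) t (K.erase e) q (x, true) - corr a b t (E.erase e.1) q.1 x ≤
      ∑ z, corr (ca a) (cb b tw) t (K.erase e) q z *
        (visitWeight (loop a b tw t F) S z + loop a b tw t (E.erase e.1) z.1) *
          corr₂ a b tw t F z.1 x := by
    by_cases hq : other q ∈ S
    · refine le_trans ?_ (hbail _ hKF' (E.erase e.1) q hq)
      linarith [corr_nonneg (a := a) (b := b) ht0 ht1 (E.erase e.1) q.1 x]
    · refine le_trans (ih _ hcard (K.erase e) rfl (E.erase e.1) hEK' hKF' (insert q S) q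
        (mem_insert_self _ _) ?_ ?_) (visitWeight_insert_le ht0 ht1 hKF' hq hT0)
      · rw [mem_insert, not_or]
        exact ⟨other_ne q, hq⟩
      · intro f hf hfE
        exact (hinv' f hf hfE).imp (mem_insert_of_mem ·) (mem_insert_of_mem ·)
  set P := (1 + t * corr (ca a) (cb b tw) t (K.erase e) p q)⁻¹ with hP
  have hα1 := one_le_step (a := ca a) (b := cb b tw) ht0 ht1 (K.erase e) p q
  have hP0 : 0 < P := inv_pos.2 (by linarith)
  have hP1 : P ≤ 1 := inv_le_one_of_one_le₀ hα1
  have harm : ∀ z, corr (ca a) (cb b tw) t K p z = P * (corr (ca a) (cb b tw) t (K.erase e) p z +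
      t * corr (ca a) (cb b tw) t (K.erase e) q z) := fun z => corr_erase ht0 ht1 heK hJ z
  have hsum : ∑ z, corr (ca a) (cb b tw) t K p z *
        (visitWeight (loop a b tw t F) S z + loop a b tw t (E.erase e.1) z.1) *
          corr₂ a b tw t F z.1 x =
      P * (∑ z, corr (ca a) (cb b tw) t (K.erase e) p z *
        (visitWeight (loop a b tw t F) S z + loop a b tw t (E.erase e.1) z.1) *
          corr₂ a b tw t F z.1 x +
      t * ∑ z, corr (ca a) (cb b tw) t (K.erase e) q z *
        (visitWeight (loop a b tw t F) S z + loop a b tw t (E.erase e.1) z.1) *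
          corr₂ a b tw t F z.1 x) := by
    rw [mul_sum, ← sum_add_distrib, mul_sum]
    refine sum_congr rfl fun z _ => ?_
    rw [harm z]; ring
  by_cases heE : e.1 ∈ E
  -- Both explorations take the step, but with different normalising factors. Replacing that of the
  -- base by that of the cover costs `P t (τ - κ)` times the base correlation, with `τ` and `κ` the
  -- base and cover correlations of the edge's end points. The loss of `loop` at `p` absorbs it
  -- through the term `z = p`.
  · have hloop := le_loop_sub_loop (K := K.erase e) ht0 ht1 heE hEK' hJ
    have hdiff : ∑ z, corr (ca a) (cb b tw) t K p z *
          (visitWeight (loop a b tw t F) S z + loop a b tw t (E.erase e.1) z.1) *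
            corr₂ a b tw t F z.1 x +
        (loop a b tw t E p.1 - loop a b tw t (E.erase e.1) p.1) * corr₂ a b tw t F p.1 x ≤
        ∑ z, corr (ca a) (cb b tw) t K p z *
          (visitWeight (loop a b tw t F) S z + loop a b tw t E z.1) * corr₂ a b tw t F z.1 x := by
      rw [← le_sub_iff_add_le', ← sum_sub_distrib]
      refine le_trans (le_of_eq ?_) (single_le_sum (fun z _ => ?_) (mem_univ p))
      · rw [corr_self ht0 ht1]; ring
      · have := loop_mono (a := a) (b := b) (tw := tw) ht0 ht1 (erase_subset e.1 E) z.1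
        have h1 := corr_nonneg (a := ca a) (b := cb b tw) ht0 ht1 K p z
        have h2 := mul_nonneg (mul_nonneg h1 (sub_nonneg.2 this)) (hT0 z.1)
        linarith
    have hfT : corr a b t E p.1 x ≤ corr₂ a b tw t F p.1 x := by
      have hEF : E ⊆ F := by
        intro i hi
        exact mem_lift.1 (hKF (hEK (mem_lift.2 hi : (i, false) ∈ lift E)))
      exact (corr_mono ht0 ht1 hEF _ _).trans (corr_le_corr₂ ht0 ht1 F _ _)
    have hf0 : 0 ≤ corr a b t E p.1 x := corr_nonneg ht0 ht1 _ _ _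
    have hstep := corr_erase (a := a) (b := b) ht0 ht1 heE hJ.fst x
    have hτ1 := one_le_step (a := a) (b := b) ht0 ht1 (E.erase e.1) p.1 q.1
    have hdelta : P * (t * (corr a b t (E.erase e.1) p.1 q.1 -
        corr (ca a) (cb b tw) t (K.erase e) p q)) * corr a b t E p.1 x ≤
        (loop a b tw t E p.1 - loop a b tw t (E.erase e.1) p.1) * corr₂ a b tw t F p.1 x := by
      refine (mul_le_mul_of_nonneg_right hloop hf0).trans (mul_le_mul_of_nonneg_left hfT ?_)
      exact sub_nonneg.2 (loop_mono ht0 ht1 (erase_subset _ _) _)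
    refine le_trans ?_ hdiff
    rw [hsum, harm, harm]
    have hPP : P * (1 + t * corr (ca a) (cb b tw) t (K.erase e) p q) = 1 := by
      rw [hP]; exact inv_mul_cancel₀ (by linarith)
    have hff : corr a b t E p.1 x * (1 + t * corr a b t (E.erase e.1) p.1 q.1) =
        corr a b t (E.erase e.1) p.1 x + t * corr a b t (E.erase e.1) q.1 x := by
      rw [hstep]; field_simp
    have hident : corr a b t E p.1 x = P * (corr a b t (E.erase e.1) p.1 x +
        t * corr a b t (E.erase e.1) q.1 x) - P * (t * (corr a b t (E.erase e.1) p.1 q.1 -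
        corr (ca a) (cb b tw) t (K.erase e) p q)) * corr a b t E p.1 x := by
      rw [← hff]
      linear_combination (-(corr a b t E p.1 x)) * hPP
    have hcomb := mul_le_mul_of_nonneg_left (add_le_add hB1 (mul_le_mul_of_nonneg_left hB2 ht0))
      hP0.le
    linarith
  -- The base edge is already gone, so only the cover can take this step. Since `other p` is
  -- unvisited, the invariant forces `other q` to be visited, and the step is paid for by `hbail`.
  · have hq : other q ∈ S := by
      rcases hinv e heK heE with h | h
      · rcases hJ with ⟨h1, h2⟩ | ⟨h1, h2⟩
        · rw [h1] at h; exact absurd h hp'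
        · rwa [h1] at h
      · rcases hJ with ⟨h1, h2⟩ | ⟨h1, h2⟩
        · rwa [h2] at h
        · rw [h2] at h; exact absurd h hp'
    have hB3 := hbail _ hKF' E q hq
    have hErase : E.erase e.1 = E := erase_eq_of_notMem heE
    rw [hErase] at hsum hB1
    rw [hsum, harm, harm]
    have hf0 : 0 ≤ corr a b t E p.1 x := corr_nonneg ht0 ht1 _ _ _
    have hcomb := mul_le_mul_of_nonneg_left (add_le_add hB1 (mul_le_mul_of_nonneg_left hB3 ht0))
      hP0.le
    nlinarith [mul_le_mul_of_nonneg_right hP1 hf0]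

/-- The correlations of a graph are not much smaller than the correlations of a double cover, summed
over the lifts. -/
theorem corr₂_sub_corr_le {t : ℝ} (ht0 : 0 ≤ t) (ht1 : t < 1) (F : Finset ι) (y x : V) :
    corr₂ a b tw t F y x - corr a b t F y x ≤
      2 * ∑ z, corr₂ a b tw t F y z * loop a b tw t F z * corr₂ a b tw t F z x := by
  have h := exploration_bound (a := a) (b := b) (tw := tw) ht0 ht1 F x _ (lift F) rfl F
    (Subset.refl _) (Subset.refl _) {(y, false)} (y, false) (mem_singleton_self _)
    (by simp [other]) (fun e he hne => absurd (mem_lift.1 he) hne)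
  refine h.trans ?_
  have hT0 : ∀ z, 0 ≤ corr₂ a b tw t F z x := fun z => corr₂_nonneg ht0 ht1 F z x
  -- The starting point may be forgotten, after which the visit weight is `loop` everywhere. Added
  -- to the other `loop` term it gives the factor `2`.
  have h1 := visitWeight_insert_le (a := a) (b := b) (tw := tw) ht0 ht1 (Subset.refl (lift F))
    (S := ∅) (q := (y, false)) (notMem_empty _) (Y := loop a b tw t F) hT0
  rw [insert_empty] at h1
  refine h1.trans (le_of_eq ?_)
  have h2 : ∀ z, visitWeight (loop a b tw t F) ∅ z = loop a b tw t F z.1 := by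
    intro z; simp [visitWeight]
  simp only [h2]
  rw [Fintype.sum_prod_type, mul_sum]
  refine sum_congr rfl fun z _ => ?_
  rw [Fintype.sum_bool]
  conv_rhs => rw [← corr₂_eq t F y z false true]
  simp only [Bool.not_true]
  ring

/-- Lieb's inequality: restricting the edges to `G`. -/
theorem corr_le_of_subset {t : ℝ} (ht0 : 0 ≤ t) (ht1 : t < 1) (x : V) {G F : Finset ι}
    (hGF : G ⊆ F) (y : V) :
    corr a b t F y x ≤ corr a b t G y x + t * ∑ i ∈ F \ G,
      (corr a b t G y (a i) * corr a b t F (b i) x +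
        corr a b t G y (b i) * corr a b t F (a i) x) := by
  -- The edges at `y` are explored in `K` and `G` together, while the correlations after leaving `G`
  -- are kept in the full set `F`.
  suffices H : ∀ (n : ℕ) (K : Finset ι), K.card = n → ∀ G ⊆ K, K ⊆ F → ∀ y,
      corr a b t K y x ≤ corr a b t G y x + t * ∑ i ∈ K \ G,
      (corr a b t G y (a i) * corr a b t F (b i) x +
        corr a b t G y (b i) * corr a b t F (a i) x) from
    H _ F rfl G hGF (Subset.refl _) y
  intro n
  induction n using Nat.strong_induction_on with
  | _ n ih =>
  intro K hn G hGK hKF y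
  have hc0 : ∀ (K : Finset ι) (x y : V), 0 ≤ corr a b t K x y := fun K x y =>
    corr_nonneg ht0 ht1 K x y
  by_cases hex : ∃ i ∈ K, a i = y ∨ b i = y
  swap
  · push Not at hex
    rw [corr_eq_of_isolated ht0 ht1 hex, corr_eq_of_isolated ht0 ht1 fun i hi => hex i (hGK hi)]
    refine le_add_of_nonneg_right (mul_nonneg ht0 (sum_nonneg fun i _ => ?_))
    exact add_nonneg (mul_nonneg (hc0 _ _ _) (hc0 _ _ _)) (mul_nonneg (hc0 _ _ _) (hc0 _ _ _))
  obtain ⟨i, hiK, hi⟩ := hex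
  obtain ⟨y', hJ⟩ : ∃ y', Joins a b i y y' := by
    rcases hi with h | h
    · exact ⟨_, Or.inl ⟨h, rfl⟩⟩
    · exact ⟨_, Or.inr ⟨rfl, h⟩⟩
  have hcard : (K.erase i).card < n := by rw [← hn]; exact card_erase_lt_of_mem hiK
  have hKF' : K.erase i ⊆ F := (erase_subset _ _).trans hKF
  have hK := corr_erase ht0 ht1 hiK hJ x
  have hκ1 := one_le_step (a := a) (b := b) ht0 ht1 (K.erase i) y y'
  by_cases hiG : i ∈ G
  · have hG' : G.erase i ⊆ K.erase i := erase_subset_erase _ hGK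
    have e1 := ih _ hcard (K.erase i) rfl (G.erase i) hG' hKF' y
    have e2 := ih _ hcard (K.erase i) rfl (G.erase i) hG' hKF' y'
    have hsd : K.erase i \ G.erase i = K \ G := by
      ext j; simp only [mem_sdiff, mem_erase]
      constructor
      · rintro ⟨⟨h1, h2⟩, h3⟩; exact ⟨h2, fun h => h3 ⟨h1, h⟩⟩
      · rintro ⟨h1, h2⟩; exact ⟨⟨fun h => h2 (h ▸ hiG), h1⟩, fun h => h2 h.2⟩
    rw [hsd] at e1 e2
    have hγ1 := one_le_step (a := a) (b := b) ht0 ht1 (G.erase i) y y'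
    set P := (1 + t * corr a b t (G.erase i) y y')⁻¹ with hP
    have hP0 : 0 < P := inv_pos.2 (by linarith)
    have harm : ∀ z, corr a b t G y z = P * (corr a b t (G.erase i) y z +
      t * corr a b t (G.erase i) y' z) := fun z => corr_erase ht0 ht1 hiG hJ z
    have hle : corr a b t K y x ≤ P * (corr a b t (K.erase i) y x +
        t * corr a b t (K.erase i) y' x) := by
      rw [hK]
      refine mul_le_mul_of_nonneg_right (inv_anti₀ (by linarith) ?_)
        (add_nonneg (hc0 _ _ _) (mul_nonneg ht0 (hc0 _ _ _)))
      have := corr_mono (a := a) (b := b) ht0 ht1 hG' y y'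
      nlinarith
    refine hle.trans ((mul_le_mul_of_nonneg_left
      (add_le_add e1 (mul_le_mul_of_nonneg_left e2 ht0)) hP0.le).trans (le_of_eq ?_))
    have hsum : ∑ i ∈ K \ G, (corr a b t G y (a i) * corr a b t F (b i) x +
        corr a b t G y (b i) * corr a b t F (a i) x) =
        P * (∑ j ∈ K \ G, (corr a b t (G.erase i) y (a j) * corr a b t F (b j) x +
          corr a b t (G.erase i) y (b j) * corr a b t F (a j) x) +
        t * ∑ j ∈ K \ G, (corr a b t (G.erase i) y' (a j) * corr a b t F (b j) x +
          corr a b t (G.erase i) y' (b j) * corr a b t F (a j) x)) := by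
      rw [mul_sum, ← sum_add_distrib, mul_sum]
      refine sum_congr rfl fun j _ => ?_
      rw [harm, harm]; ring
    rw [hsum, harm x]
    ring
  · have hG' : G ⊆ K.erase i := fun j hj => mem_erase.2 ⟨fun h => hiG (h ▸ hj), hGK hj⟩
    have e1 := ih _ hcard (K.erase i) rfl G hG' hKF' y
    have hle : corr a b t K y x ≤ corr a b t (K.erase i) y x + t * corr a b t F y' x := by
      rw [hK]
      have h1 := corr_mono (a := a) (b := b) ht0 ht1 hKF' y' x
      refine (mul_le_of_le_one_left (add_nonneg (hc0 _ _ _) (mul_nonneg ht0 (hc0 _ _ _)))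
        (inv_le_one_of_one_le₀ hκ1)).trans ?_
      have := mul_le_mul_of_nonneg_left h1 ht0
      linarith
    have hsd : K \ G = insert i (K.erase i \ G) := by
      ext j; simp only [mem_sdiff, mem_erase, mem_insert]
      constructor
      · rintro ⟨h1, h2⟩
        by_cases h : j = i
        · exact Or.inl h
        · exact Or.inr ⟨⟨h, h1⟩, h2⟩
      · rintro (h | ⟨⟨-, h1⟩, h2⟩)
        · rw [h]; exact ⟨hiK, hiG⟩
        · exact ⟨h1, h2⟩
    rw [hsd, sum_insert (by simp)]
    -- The step leaves `G` directly from `y`; it is the `i` term of the sum, whose first factor is a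
    -- self-correlation equal to `1`.
    have hy' : corr a b t F y' x ≤ corr a b t G y (a i) * corr a b t F (b i) x +
        corr a b t G y (b i) * corr a b t F (a i) x := by
      rcases hJ with ⟨rfl, rfl⟩ | ⟨rfl, rfl⟩
      · rw [corr_self ht0 ht1, one_mul]
        exact le_add_of_nonneg_right (mul_nonneg (hc0 _ _ _) (hc0 _ _ _))
      · rw [corr_self ht0 ht1 G, one_mul]
        exact le_add_of_nonneg_left (mul_nonneg (hc0 _ _ _) (hc0 _ _ _))
    have := mul_le_mul_of_nonneg_left hy' ht0
    linarith

end Exploration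

end IsingCover

/-! ### Cayley graphs, double covers of groups and the telescoping bound. -/

namespace IsingCover

open Finset

section Cayley

set_option linter.unusedSectionVars false

variable {κ B B' A : Type*} [Fintype κ] [DecidableEq κ]
  [AddCommGroup B] [Fintype B] [DecidableEq B] [AddCommGroup B'] [Fintype B'] [DecidableEq B']
  [AddCommGroup A] [Fintype A] [DecidableEq A]

/-- The two-point function of the Cayley graph of `B` with steps `e`. -/
noncomputable def cayley (e : κ → B) (t : ℝ) (F : Finset (B × κ)) (x y : B) : ℝ :=
  corr (fun p : B × κ => p.1) (fun p => p.1 + e p.2) t F x y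

theorem cayley_translate (e : κ → B) (t : ℝ) (x y : B) :
    cayley e t univ x y = cayley e t univ 0 (y - x) := by
  have hφ : Function.Injective fun b : B => b + x := add_left_injective x
  have hj : Function.Bijective fun p : B × κ => (p.1 + x, p.2) := by
    refine Function.bijective_iff_has_inverse.2 ⟨fun p => (p.1 - x, p.2), fun p => ?_, fun p => ?_⟩
      <;> simp
  have h := corr_embed (a := fun p : B × κ => p.1) (b := fun p => p.1 + e p.2)
    (a' := fun p : B × κ => p.1) (b' := fun p => p.1 + e p.2) hφ (F := univ)
    (j := fun p => (p.1 + x, p.2)) hj.1.injOn (fun p _ => Or.inl ⟨rfl, add_right_comm _ _ _⟩) t 0 (y - x)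
  rw [image_univ_of_surjective hj.2] at h
  simpa [cayley] using h

variable (ρ : B' →+ B) (g : B')

/-- `ρ` is surjective with kernel `{0, g}`, and `g ≠ 0`. -/
structure IsDouble : Prop where
  surj : Function.Surjective ρ
  ker : ∀ x, ρ x = 0 ↔ x = 0 ∨ x = g
  ne : g ≠ 0

variable {ρ g}

namespace IsDouble
variable (h : IsDouble ρ g)
include h

theorem map_self : ρ g = 0 := (h.ker g).2 (Or.inr rfl)

theorem add_self : g + g = 0 := by
  have h1 : ρ (g + g) = 0 := by rw [map_add, h.map_self, add_zero]
  rcases (h.ker _).1 h1 with h2 | h2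
  · exact h2
  · exact absurd (add_eq_left.1 h2) h.ne

theorem filter_eq (c : B') : (univ.filter fun x => ρ x = ρ c) = {c, c + g} := by
  ext x
  simp only [mem_filter, mem_univ, true_and, mem_insert, mem_singleton]
  rw [← sub_eq_zero, ← map_sub, h.ker, sub_eq_zero, sub_eq_iff_eq_add']

theorem sum_fiber (f : B' → ℝ) (c : B') :
    ∑ x with ρ x = ρ c, f x = f c + f (c + g) := by
  rw [h.filter_eq, sum_pair]
  intro h1
  exact h.ne (left_eq_add.1 h1)

/-- A choice of sheets for a double cover of groups. -/
noncomputable def sheet (p : B × Bool) : B' :=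
  Function.surjInv h.surj p.1 + if p.2 then g else 0

theorem map_sheet (p : B × Bool) : ρ (h.sheet p) = p.1 := by
  unfold sheet
  rw [map_add, Function.surjInv_eq h.surj]
  split_ifs <;> simp [h.map_self]

theorem sheet_other (p : B × Bool) : h.sheet (other p) = h.sheet p + g := by
  obtain ⟨b, u⟩ := p
  cases u
  · simp [sheet, other]
  · simp [sheet, other, add_assoc, h.add_self]

theorem sheet_bijective : Function.Bijective h.sheet := by
  constructor
  · intro p q hpq
    have h1 : p.1 = q.1 := by rw [← h.map_sheet p, hpq, h.map_sheet]
    by_contra hne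
    rw [eq_other h1 hne, h.sheet_other] at hpq
    exact h.ne (add_eq_left.1 hpq)
  · intro x
    have h1 : ρ x = ρ (h.sheet (ρ x, false)) := by rw [h.map_sheet]
    have h2 : x ∈ univ.filter fun y => ρ y = ρ (h.sheet (ρ x, false)) := by simpa using h1
    rw [h.filter_eq] at h2
    rcases mem_insert.1 h2 with h3 | h3
    · exact ⟨_, h3.symm⟩
    · refine ⟨other (ρ x, false), ?_⟩
      rw [h.sheet_other, ← mem_singleton.1 h3]

/-- The sum of the two-point function of the double cover over a fibre. -/
noncomputable def fiberTau (_ : IsDouble ρ g) (e' : κ → B') (t : ℝ) (c : B) : ℝ :=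
  ∑ x with ρ x = c, cayley e' t univ 0 x

variable {e : κ → B} {e' : κ → B'} (he : ∀ i, ρ (e' i) = e i)
include he

/-- In the coordinates given by the sheets the Cayley graph of `B'` is a twisted double cover of
that of `B`. The twist does not depend on the sheet because translation by `g` exchanges the sheets.
-/
theorem exists_twist : ∃ tw : B × κ → Bool, ∀ (p : B × κ) (u : Bool),
    h.sheet (p.1, u) + e' p.2 = h.sheet (p.1 + e p.2, xor u (tw p)) := by
  have : ∀ p : B × κ, ∃ w : Bool, h.sheet (p.1, false) + e' p.2 = h.sheet (p.1 + e p.2, w) := by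
    intro p
    obtain ⟨q, hq⟩ := h.sheet_bijective.2 (h.sheet (p.1, false) + e' p.2)
    refine ⟨q.2, ?_⟩
    rw [← hq]
    congr 1
    refine Prod.ext ?_ rfl
    rw [← h.map_sheet q, hq, map_add, h.map_sheet, he]
  choose tw htw using this
  refine ⟨tw, fun p u => ?_⟩
  cases u
  · simpa using htw p
  · have h1 := h.sheet_other (p.1, false)
    have h2 := h.sheet_other (p.1 + e p.2, tw p)
    simp only [other, Bool.not_false] at h1 h2
    rw [h1, add_right_comm, htw p, ← h2]
    simp

theorem corr_cover {tw : B × κ → Bool}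
    (htw : ∀ (p : B × κ) (u : Bool),
      h.sheet (p.1, u) + e' p.2 = h.sheet (p.1 + e p.2, xor u (tw p))) (t : ℝ) (p q : B × Bool) :
    corr (ca fun p : B × κ => p.1) (cb (fun p : B × κ => p.1 + e p.2) tw) t (lift univ) p q =
      cayley e' t univ 0 (h.sheet q - h.sheet p) := by
  let j : (B × κ) × Bool → B' × κ := fun r => (h.sheet (r.1.1, r.2), r.1.2)
  have hj : Function.Bijective j := by
    constructor
    · rintro ⟨⟨b, i⟩, u⟩ ⟨⟨b', i'⟩, u'⟩ h1
      obtain ⟨h1, h2⟩ := Prod.mk.inj h1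
      have h3 := h.sheet_bijective.1 h1
      simp_all
    · rintro ⟨x, i⟩
      obtain ⟨⟨b, u⟩, hq⟩ := h.sheet_bijective.2 x
      exact ⟨((b, i), u), Prod.ext hq rfl⟩
  have hl : lift (univ : Finset (B × κ)) = univ := by ext; simp [mem_lift]
  have h1 := corr_embed (a := fun p : B' × κ => p.1) (b := fun p => p.1 + e' p.2)
    (a' := ca fun p : B × κ => p.1) (b' := cb (fun p : B × κ => p.1 + e p.2) tw)
    h.sheet_bijective.1 (F := univ) (j := j) hj.1.injOn
    (fun r _ => Or.inl ⟨rfl, htw r.1 r.2⟩) t p q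
  rw [image_univ_of_surjective hj.2] at h1
  rw [hl, ← h1, ← cayley_translate]
  rfl

theorem corr₂_cover {tw : B × κ → Bool}
    (htw : ∀ (p : B × κ) (u : Bool),
      h.sheet (p.1, u) + e' p.2 = h.sheet (p.1 + e p.2, xor u (tw p))) (t : ℝ) (x y : B) :
    corr₂ (fun p : B × κ => p.1) (fun p : B × κ => p.1 + e p.2) tw t univ x y =
      h.fiberTau e' t (y - x) := by
  unfold corr₂ fiberTau
  rw [h.corr_cover he htw, h.corr_cover he htw]
  have h1 : y - x = ρ (h.sheet (y, false) - h.sheet (x, false)) := by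
    rw [map_sub, h.map_sheet, h.map_sheet]
  rw [h1, h.sum_fiber]
  have h2 := h.sheet_other (y, false)
  simp only [other, Bool.not_false] at h2
  rw [h2, sub_add_eq_add_sub]

theorem loop_cover {tw : B × κ → Bool}
    (htw : ∀ (p : B × κ) (u : Bool),
      h.sheet (p.1, u) + e' p.2 = h.sheet (p.1 + e p.2, xor u (tw p))) (t : ℝ) (y : B) :
    loop (fun p : B × κ => p.1) (fun p : B × κ => p.1 + e p.2) tw t univ y =
      cayley e' t univ 0 g := by
  unfold loop
  rw [h.corr_cover he htw]
  have h2 := h.sheet_other (y, false)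
  simp only [other, Bool.not_false] at h2
  rw [h2, add_sub_cancel_left]

theorem cayley_mul_le {t : ℝ} (ht0 : 0 ≤ t) (ht1 : t < 1) (c : B) :
    cayley e t univ 0 c * (1 + cayley e' t univ 0 g) ≤ h.fiberTau e' t c := by
  obtain ⟨tw, htw⟩ := h.exists_twist he
  have h1 := corr_mul_le_corr₂ (a := fun p : B × κ => p.1) (b := fun p : B × κ => p.1 + e p.2)
    (tw := tw) ht0 ht1 univ 0 c
  rwa [h.corr₂_cover he htw, h.loop_cover he htw, sub_zero] at h1

/-- By translation invariance the loop function is the same at every vertex, so it leaves the sum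
and a convolution remains. -/
theorem fiberTau_sub_le {t : ℝ} (ht0 : 0 ≤ t) (ht1 : t < 1) (c : B) :
    h.fiberTau e' t c - cayley e t univ 0 c ≤
      2 * cayley e' t univ 0 g * ∑ z, h.fiberTau e' t z * h.fiberTau e' t (c - z) := by
  obtain ⟨tw, htw⟩ := h.exists_twist he
  have h1 := corr₂_sub_corr_le (a := fun p : B × κ => p.1) (b := fun p : B × κ => p.1 + e p.2)
    (tw := tw) ht0 ht1 univ 0 c
  simp only [h.corr₂_cover he htw, h.loop_cover he htw, sub_zero] at h1
  refine h1.trans (le_of_eq ?_)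
  rw [mul_sum, mul_sum]
  exact sum_congr rfl fun z _ => by ring

end IsDouble

/-- The two-point function of a Cayley graph, summed over the fibres of `π`. -/
noncomputable def sumTau (e : κ → B) (t : ℝ) (π : B →+ A) (x : A) : ℝ :=
  ∑ b with π b = x, cayley e t univ 0 b

theorem cayley_nonneg {t : ℝ} (ht0 : 0 ≤ t) (ht1 : t < 1) (e : κ → B) (F : Finset (B × κ))
    (x y : B) : 0 ≤ cayley e t F x y := corr_nonneg ht0 ht1 _ _ _

theorem sumTau_nonneg {t : ℝ} (ht0 : 0 ≤ t) (ht1 : t < 1) (e : κ → B) (π : B →+ A) (x : A) :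
    0 ≤ sumTau e t π x := sum_nonneg fun _ _ => cayley_nonneg ht0 ht1 _ _ _ _

theorem one_le_sumTau {t : ℝ} (ht0 : 0 ≤ t) (ht1 : t < 1) (e : κ → B) (π : B →+ A) :
    1 ≤ sumTau e t π 0 := by
  have h : cayley e t univ 0 0 = 1 := corr_self ht0 ht1 _ _
  rw [← h]
  exact single_le_sum (f := fun b => cayley e t univ 0 b)
    (fun _ _ => cayley_nonneg ht0 ht1 _ _ _ _) (by simp)

/-- The sum over a fibre of a composite. -/
theorem sum_fiber_comp (ρ : B' →+ B) (π : B →+ A) (f : B' → ℝ) (x : A) :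
    ∑ c with (π.comp ρ) c = x, f c = ∑ b with π b = x, ∑ c with ρ c = b, f c := by
  rw [← sum_fiberwise_of_maps_to (s := univ.filter fun c => (π.comp ρ) c = x)
    (t := univ.filter fun b => π b = x) (g := ρ)]
  · refine sum_congr rfl fun b hb => sum_congr ?_ fun _ _ => rfl
    ext c
    simp only [mem_filter, mem_univ, true_and] at hb ⊢
    constructor
    · exact fun h => h.2
    · intro h; exact ⟨by simp [h, hb], h⟩
  · intro c hc
    simpa using hc

variable {e : κ → B} {e' : κ → B'}

theorem IsDouble.sumTau_comp (h : IsDouble ρ g) (t : ℝ) (π : B →+ A) (x : A) :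
    sumTau e' t (π.comp ρ) x = ∑ b with π b = x, h.fiberTau e' t b :=
  sum_fiber_comp ρ π _ x

theorem IsDouble.sumTau_mul_le (h : IsDouble ρ g) (he : ∀ i, ρ (e' i) = e i) {t : ℝ} (ht0 : 0 ≤ t)
    (ht1 : t < 1) (π : B →+ A) (x : A) :
    sumTau e t π x * (1 + cayley e' t univ 0 g) ≤ sumTau e' t (π.comp ρ) x := by
  rw [h.sumTau_comp]
  unfold sumTau
  rw [sum_mul]
  exact sum_le_sum fun b _ => h.cayley_mul_le he ht0 ht1 b

theorem IsDouble.sumTau_le (h : IsDouble ρ g) (he : ∀ i, ρ (e' i) = e i) {t : ℝ} (ht0 : 0 ≤ t)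
    (ht1 : t < 1) (π : B →+ A) (x : A) :
    sumTau e t π x ≤ sumTau e' t (π.comp ρ) x :=
  (le_mul_of_one_le_right (sumTau_nonneg ht0 ht1 _ _ _)
    (le_add_of_nonneg_right (cayley_nonneg ht0 ht1 _ _ _ _))).trans (h.sumTau_mul_le he ht0 ht1 π x)

theorem IsDouble.sumTau_sub_le (h : IsDouble ρ g) (he : ∀ i, ρ (e' i) = e i) {t : ℝ} (ht0 : 0 ≤ t)
    (ht1 : t < 1) (π : B →+ A) (x : A) :
    sumTau e' t (π.comp ρ) x - sumTau e t π x ≤ 2 * cayley e' t univ 0 g *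
      ∑ w, sumTau e' t (π.comp ρ) w * sumTau e' t (π.comp ρ) (x - w) := by
  rw [h.sumTau_comp]
  unfold sumTau
  rw [← sum_sub_distrib]
  refine (sum_le_sum fun b _ => h.fiberTau_sub_le he ht0 ht1 b).trans (le_of_eq ?_)
  rw [← mul_sum]
  congr 1
  rw [sum_comm]
  have h1 : ∀ z : B, ∑ b with π b = x, h.fiberTau e' t z * h.fiberTau e' t (b - z) =
      h.fiberTau e' t z * sumTau e' t (π.comp ρ) (x - π z) := by
    intro z
    rw [← mul_sum, h.sumTau_comp]
    congr 1
    refine sum_bij (fun b _ => b - z) ?_ ?_ ?_ ?_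
    · intro b hb
      simp only [mem_filter, mem_univ, true_and] at hb ⊢
      rw [map_sub, hb]
    · intro b _ c _ hbc; exact sub_left_injective hbc
    · intro b hb
      refine ⟨b + z, ?_, by simp⟩
      simp only [mem_filter, mem_univ, true_and] at hb ⊢
      rw [map_add, hb]; simp
    · intro b _; rfl
  simp only [h1]
  rw [← sum_fiberwise_of_maps_to (s := (univ : Finset B)) (t := univ) (g := π) fun _ _ => mem_univ _]
  refine sum_congr rfl fun w _ => ?_
  change _ = sumTau e' t (π.comp ρ) w * sumTau e' t (π.comp ρ) (x - w)
  rw [h.sumTau_comp (e' := e') t π w, sum_mul]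
  refine sum_congr rfl fun z hz => ?_
  rw [(mem_filter.1 hz).2]

/-- The bound on the difference between the two-point function `τ` and the sum over fibres. -/
def PlateauBound (e : κ → B) (t : ℝ) (π : B →+ A) (τ : A → ℝ) : Prop :=
  ∀ x, sumTau e t π x - τ x ≤ 2 * (sumTau e t π 0 - 1) * ∑ w, sumTau e t π w * sumTau e t π (x - w)

/-- A doubling adds at most `2 ℓ` times the new convolution, where `ℓ` is the correlation of `0` and
`g`. The lower bound gives `sumTau' 0 ≥ (1 + ℓ) sumTau 0 ≥ sumTau 0 + ℓ`, so the prefactor `sumTau 0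
- 1` grows by enough to absorb it. The convolution itself only increases. -/
theorem IsDouble.plateauBound (h : IsDouble ρ g) (he : ∀ i, ρ (e' i) = e i) {t : ℝ} (ht0 : 0 ≤ t)
    (ht1 : t < 1) {π : B →+ A} {τ : A → ℝ} (hP : PlateauBound e t π τ) :
    PlateauBound e' t (π.comp ρ) τ := by
  intro x
  have h1 := h.sumTau_sub_le he ht0 ht1 π x
  have h2 := hP x
  have h3 := h.sumTau_mul_le he ht0 ht1 π 0
  have h4 := one_le_sumTau ht0 ht1 e π
  have h5 := cayley_nonneg ht0 ht1 e' univ 0 g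
  have h6 : ∑ w, sumTau e t π w * sumTau e t π (x - w) ≤
      ∑ w, sumTau e' t (π.comp ρ) w * sumTau e' t (π.comp ρ) (x - w) :=
    sum_le_sum fun w _ => mul_le_mul (h.sumTau_le he ht0 ht1 π _) (h.sumTau_le he ht0 ht1 π _)
      (sumTau_nonneg ht0 ht1 _ _ _) (sumTau_nonneg ht0 ht1 _ _ _)
  have h7 : 0 ≤ ∑ w, sumTau e t π w * sumTau e t π (x - w) :=
    sum_nonneg fun w _ => mul_nonneg (sumTau_nonneg ht0 ht1 _ _ _) (sumTau_nonneg ht0 ht1 _ _ _)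
  set S := ∑ w, sumTau e t π w * sumTau e t π (x - w)
  set S' := ∑ w, sumTau e' t (π.comp ρ) w * sumTau e' t (π.comp ρ) (x - w)
  have h8 : (sumTau e t π 0 - 1) * S ≤ (sumTau e t π 0 - 1) * S' :=
    mul_le_mul_of_nonneg_left h6 (by linarith)
  have h9 : (cayley e' t univ 0 g + sumTau e t π 0 - 1) * S' ≤
      (sumTau e' t (π.comp ρ) 0 - 1) * S' := by
    refine mul_le_mul_of_nonneg_right ?_ (h7.trans h6)
    nlinarith
  linarith

end Cayley

end IsingCover

/-! ### Discrete tori and the tower of doublings. -/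

namespace IsingCover

open Finset

section Torus
variable {d : ℕ}

/-- The discrete torus with periods `N`. -/
abbrev Tor (N : Fin d → ℕ) : Type := ∀ i, ZMod (N i)

/-- The unit vectors. -/
def unitVec (N : Fin d → ℕ) (i : Fin d) : Tor N := Pi.single i 1

/-- The quotient map from the lattice to the torus. -/
def castTor (N : Fin d → ℕ) : (Fin d → ℤ) →+ Tor N where
  toFun v i := (v i : ZMod (N i))
  map_zero' := by ext; simp
  map_add' v w := by ext; simp

theorem castTor_surjective (N : Fin d → ℕ) : Function.Surjective (castTor N) := fun x =>
  ⟨fun i => (ZMod.intCast_surjective (x i)).choose,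
    funext fun i => (ZMod.intCast_surjective (x i)).choose_spec⟩

theorem castTor_single (N : Fin d → ℕ) (i : Fin d) : castTor N (Pi.single i 1) = unitVec N i := by
  ext j
  by_cases h : j = i
  · subst h; simp [castTor, unitVec]
  · simp [castTor, unitVec, Pi.single_eq_of_ne h]

theorem castTor_eq_zero {N : Fin d → ℕ} {v : Fin d → ℤ} :
    castTor N v = 0 ↔ ∀ i, (N i : ℤ) ∣ v i := by
  rw [funext_iff]
  exact forall_congr' fun i => ZMod.intCast_zmod_eq_zero_iff_dvd (v i) (N i)

/-- The projection of a torus to a torus with smaller periods. -/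
def proj {M N : Fin d → ℕ} (h : ∀ i, M i ∣ N i) : Tor N →+ Tor M where
  toFun x i := ZMod.castHom (h i) (ZMod (M i)) (x i)
  map_zero' := by ext i; exact map_zero _
  map_add' x y := by ext i; exact map_add _ _ _

theorem proj_castTor {M N : Fin d → ℕ} (h : ∀ i, M i ∣ N i) (v : Fin d → ℤ) :
    proj h (castTor N v) = castTor M v := by
  ext i
  exact map_intCast (ZMod.castHom (h i) (ZMod (M i))) (v i)

theorem proj_surjective {M N : Fin d → ℕ} (h : ∀ i, M i ∣ N i) : Function.Surjective (proj h) := by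
  intro x
  obtain ⟨v, rfl⟩ := castTor_surjective M x
  exact ⟨_, proj_castTor h v⟩

theorem proj_unitVec {M N : Fin d → ℕ} (h : ∀ i, M i ∣ N i) (i : Fin d) :
    proj h (unitVec N i) = unitVec M i := by
  rw [← castTor_single, proj_castTor, castTor_single]

theorem proj_comp {L M N : Fin d → ℕ} (h : ∀ i, L i ∣ M i) (h' : ∀ i, M i ∣ N i)
    (h'' : ∀ i, L i ∣ N i) : (proj h).comp (proj h') = proj h'' := by
  refine AddMonoidHom.ext fun x => ?_
  obtain ⟨v, rfl⟩ := castTor_surjective N x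
  rw [AddMonoidHom.comp_apply, proj_castTor, proj_castTor, proj_castTor]

theorem proj_self {N : Fin d → ℕ} (h : ∀ i, N i ∣ N i) (x : Tor N) : proj h x = x := by
  obtain ⟨v, rfl⟩ := castTor_surjective N x
  rw [proj_castTor]

theorem isDouble_proj {M N : Fin d → ℕ} [∀ i, NeZero (M i)] (h : ∀ i, M i ∣ N i) (j : Fin d)
    (hj : N j = 2 * M j) (hne : ∀ i ≠ j, N i = M i) :
    IsDouble (proj h) (castTor N (Pi.single j (M j : ℤ))) where
  surj := proj_surjective h
  ker x := by
    obtain ⟨v, rfl⟩ := castTor_surjective N x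
    have hM : (M j : ℤ) ≠ 0 := by exact_mod_cast NeZero.ne (M j)
    have e : castTor N v = castTor N (Pi.single j (M j : ℤ)) ↔
        ∀ i, (N i : ℤ) ∣ (v - Pi.single j (M j : ℤ) : Fin d → ℤ) i := by
      rw [← castTor_eq_zero, map_sub, sub_eq_zero]
    rw [proj_castTor, castTor_eq_zero, castTor_eq_zero, e]
    constructor
    · intro hv
      obtain ⟨k, hk⟩ := hv j
      -- The `j`-th coordinate is `k M_j` modulo `2 M_j`, so the parity of `k` decides between the
      -- two kernel elements.
      rcases Int.even_or_odd k with ⟨m, hm⟩ | ⟨m, hm⟩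
      · left
        intro i
        by_cases hi : i = j
        · subst hi
          exact ⟨m, by rw [hk, hj, hm]; push_cast; ring⟩
        · rw [hne i hi]; exact hv i
      · right
        intro i
        by_cases hi : i = j
        · subst hi
          refine ⟨m, ?_⟩
          rw [Pi.sub_apply, Pi.single_eq_same, hk, hj, hm]; push_cast; ring
        · rw [hne i hi, Pi.sub_apply, Pi.single_eq_of_ne hi, sub_zero]; exact hv i
    · rintro (hv | hv) i
      · exact (Int.natCast_dvd_natCast.2 (h i)).trans (hv i)
      · have h1 := (Int.natCast_dvd_natCast.2 (h i)).trans (hv i)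
        by_cases hi : i = j
        · subst hi
          rw [Pi.sub_apply, Pi.single_eq_same] at h1
          simpa using h1
        · rwa [Pi.sub_apply, Pi.single_eq_of_ne hi, sub_zero] at h1
  ne := by
    rw [Ne, castTor_eq_zero]
    intro hv
    have h1 := hv j
    rw [Pi.single_eq_same, hj] at h1
    have h2 := Nat.le_of_dvd (Nat.pos_of_ne_zero (NeZero.ne (M j))) (Int.natCast_dvd_natCast.1 h1)
    have := Nat.pos_of_ne_zero (NeZero.ne (M j))
    omega

variable {r : ℕ} [NeZero r]

/-- The two-point function on a torus, summed over the fibres of the projection to the torus with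
period `r`. -/
noncomputable def torSum (t : ℝ) {N : Fin d → ℕ} [∀ i, NeZero (N i)] (h : ∀ i, r ∣ N i)
    (x : Fin d → ZMod r) : ℝ :=
  sumTau (A := Tor fun _ : Fin d => r) (unitVec N) t (proj (M := fun _ => r) h) x

/-- The difference between `torSum` and the two-point function on the torus with period `r` is
controlled by the convolution square of `torSum`. -/
def TorBound (t : ℝ) {N : Fin d → ℕ} [∀ i, NeZero (N i)] (h : ∀ i, r ∣ N i) : Prop :=
  PlateauBound (A := Tor fun _ : Fin d => r) (unitVec N) t (proj (M := fun _ => r) h)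
    (cayley (unitVec fun _ : Fin d => r) t univ 0)

theorem torBound_self {t : ℝ} (ht0 : 0 ≤ t) (ht1 : t < 1) (h : ∀ _ : Fin d, r ∣ r) :
    TorBound (r := r) (d := d) t (N := fun _ => r) h := by
  intro x
  have e : sumTau (A := Tor fun _ : Fin d => r) (unitVec fun _ : Fin d => r) t
      (proj (M := fun _ => r) h) x = cayley (unitVec fun _ : Fin d => r) t univ 0 x := by
    unfold sumTau
    rw [sum_filter]
    simp only [proj_self]
    simp
  rw [e, sub_self]
  have h1 := one_le_sumTau ht0 ht1 (unitVec fun _ : Fin d => r)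
    (proj (M := fun _ : Fin d => r) (N := fun _ => r) h)
  exact mul_nonneg (mul_nonneg zero_le_two (sub_nonneg.2 h1)) (sum_nonneg fun w _ =>
    mul_nonneg (sumTau_nonneg ht0 ht1 _ _ _) (sumTau_nonneg ht0 ht1 _ _ _))

theorem torBound_step {t : ℝ} (ht0 : 0 ≤ t) (ht1 : t < 1) {M N : Fin d → ℕ}
    [∀ i, NeZero (M i)] [∀ i, NeZero (N i)] (hM : ∀ i, r ∣ M i) (hN : ∀ i, r ∣ N i) (j : Fin d)
    (hj : N j = 2 * M j) (hne : ∀ i ≠ j, N i = M i) :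
    (TorBound (r := r) t hM → TorBound (r := r) t hN) ∧ ∀ x, torSum t hM x ≤ torSum t hN x := by
  have h : ∀ i, M i ∣ N i := by
    intro i
    by_cases hi : i = j
    · rw [hi, hj]; exact Dvd.intro_left 2 rfl
    · rw [hne i hi]
  have hD := isDouble_proj h j hj hne
  have hc : (proj (M := fun _ : Fin d => r) hM).comp (proj h) = proj (M := fun _ => r) hN :=
    proj_comp _ _ _
  constructor
  · intro hB
    have := hD.plateauBound (proj_unitVec h) ht0 ht1 hB
    rwa [hc] at this
  · intro x
    have := hD.sumTau_le (proj_unitVec h) ht0 ht1 (proj (M := fun _ : Fin d => r) hM) x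
    rwa [hc] at this

/-- Only covers of degree two are available, so the coordinates are doubled one after another; this
is why tori with unequal periods are allowed. -/
theorem torBound_double {t : ℝ} (ht0 : 0 ≤ t) (ht1 : t < 1) {M : Fin d → ℕ}
    [∀ i, NeZero (M i)] (hM : ∀ i, r ∣ M i) (s : Finset (Fin d)) :
    ∀ (N : Fin d → ℕ) [∀ i, NeZero (N i)] (hN : ∀ i, r ∣ N i),
      (∀ i, N i = if i ∈ s then 2 * M i else M i) →
    (TorBound (r := r) t hM → TorBound (r := r) t hN) ∧ ∀ x, torSum t hM x ≤ torSum t hN x := by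
  induction s using Finset.induction_on with
  | empty =>
    intro N _ hN hNM
    have : N = M := funext fun i => by simpa using hNM i
    subst this
    exact ⟨id, fun _ => le_rfl⟩
  | insert j s hj ih =>
    intro N _ hN hNM
    let N' : Fin d → ℕ := fun i => if i ∈ s then 2 * M i else M i
    have : ∀ i, NeZero (N' i) := fun i => ⟨by
      have := NeZero.ne (M i)
      simp only [N']
      split_ifs <;> omega⟩
    have hN' : ∀ i, r ∣ N' i := fun i => by
      simp only [N']
      split_ifs
      · exact (hM i).mul_left 2
      · exact hM i
    obtain ⟨h1, h2⟩ := ih N' hN' fun i => rfl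
    obtain ⟨h3, h4⟩ := torBound_step (r := r) ht0 ht1 hN' hN j (by simp [hNM, N', hj])
      (fun i hi => by simp [hNM, N', hi])
    exact ⟨fun h => h3 (h1 h), fun x => (h2 x).trans (h4 x)⟩

instance neZero_dyadic (k : ℕ) : NeZero (r * 2 ^ k) := ⟨by
  have := NeZero.ne r
  positivity⟩

omit [NeZero r] in
theorem dvd_dyadic (k : ℕ) (_ : Fin d) : r ∣ r * 2 ^ k := Dvd.intro _ rfl

theorem dyadic_step {t : ℝ} (ht0 : 0 ≤ t) (ht1 : t < 1) (k : ℕ) :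
    (TorBound (r := r) (d := d) t (N := fun _ => r * 2 ^ k) (dvd_dyadic k) →
      TorBound (r := r) (d := d) t (N := fun _ => r * 2 ^ (k + 1)) (dvd_dyadic (k + 1))) ∧
    ∀ x : Fin d → ZMod r, torSum t (N := fun _ => r * 2 ^ k) (dvd_dyadic k) x ≤
      torSum t (N := fun _ => r * 2 ^ (k + 1)) (dvd_dyadic (k + 1)) x :=
  torBound_double ht0 ht1 (dvd_dyadic k) univ _ (dvd_dyadic (k + 1)) fun i => by
    simp [pow_succ]; ring

theorem dyadic_bound {t : ℝ} (ht0 : 0 ≤ t) (ht1 : t < 1) (k : ℕ) :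
    TorBound (r := r) (d := d) t (N := fun _ => r * 2 ^ k) (dvd_dyadic k) := by
  induction k with
  | zero =>
    have h : ∀ _ : Fin d, r ∣ r := fun _ => dvd_rfl
    have := torBound_self (r := r) (d := d) ht0 ht1 h
    simp only [pow_zero]
    have key : ∀ (N : Fin d → ℕ) [∀ i, NeZero (N i)] (hN : ∀ i, r ∣ N i), N = (fun _ => r) →
        TorBound (r := r) t hN := by
      intro N _ hN hNr
      subst hNr
      exact this
    exact key _ _ (by funext; simp)
  | succ k ih => exact (dyadic_step ht0 ht1 k).1 ih

theorem dyadic_mono {t : ℝ} (ht0 : 0 ≤ t) (ht1 : t < 1) (x : Fin d → ZMod r) :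
    Monotone fun k => torSum t (N := fun _ : Fin d => r * 2 ^ k) (dvd_dyadic k) x :=
  monotone_nat_of_le_succ fun k => (dyadic_step ht0 ht1 k).2 x

end Torus

end IsingCover

/-! ### Translation between the Gibbs measures of the statement and edge-weight correlations; boxes
inside tori. -/

namespace IsingCover

open Finset IsingTorus

section Convert
variable {V ι : Type*} [Fintype V]

theorem exp_mul_spin (β s : ℝ) (hs : s = 1 ∨ s = -1) :
    Real.exp (β * s) = Real.cosh β * (1 + Real.tanh β * s) := by
  have hc : Real.cosh β ≠ 0 := (Real.cosh_pos β).ne'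
  rw [Real.tanh_eq_sinh_div_cosh]
  rcases hs with rfl | rfl
  · rw [mul_one, mul_one, mul_add, mul_div_cancel₀ _ hc, mul_one, Real.cosh_add_sinh]
  · field_simp
    rw [← Real.cosh_sub_sinh]
    ring_nf

theorem exp_hamiltonian (G : SimpleGraph V) (β : ℝ) {a b : ι → V} {F : Finset ι}
    (hF : Set.InjOn (fun i => s(a i, b i)) F)
    (hG : ∀ e, e ∈ G.edgeSet ↔ ∃ i ∈ F, s(a i, b i) = e) (σ : V → ℤˣ) :
    Real.exp (-β * hamiltonian G σ) =
      Real.cosh β ^ F.card * wt a b (fun _ => Real.tanh β) F σ := by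
  classical
  have h1 : -β * hamiltonian G σ = ∑ i ∈ F, β * (sp σ (a i) * sp σ (b i)) := by
    unfold hamiltonian
    rw [neg_mul_neg, mul_sum]
    refine Eq.trans (sum_congr ?_ fun _ _ => rfl) (sum_image (s := F) (g := fun i => s(a i, b i))
      (f := fun e => β * edgeSpin σ e) hF)
    ext e
    rw [SimpleGraph.mem_edgeFinset, hG, mem_image]
  rw [h1, Real.exp_sum]
  unfold wt
  rw [← prod_const, ← prod_mul_distrib]
  refine prod_congr rfl fun i _ => exp_mul_spin _ _ ?_
  rcases sp_cases σ (a i) with h | h <;> rcases sp_cases σ (b i) with h' | h' <;> simp [h, h']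

theorem twoPoint_eq_corr [DecidableEq V] (G : SimpleGraph V) (β : ℝ) {a b : ι → V} {F : Finset ι}
    (hF : Set.InjOn (fun i => s(a i, b i)) F)
    (hG : ∀ e, e ∈ G.edgeSet ↔ ∃ i ∈ F, s(a i, b i) = e) (x y : V) :
    twoPoint G β x y = corr a b (Real.tanh β) F x y := by
  unfold twoPoint expectation partitionFunction corr
  have hC : Real.cosh β ^ F.card ≠ 0 := pow_ne_zero _ (Real.cosh_pos β).ne'
  rw [one_div_mul_eq_div, ← mul_div_mul_left (num _ _ _ _ _ _) _ hC]
  unfold num part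
  rw [mul_sum, mul_sum]
  congr 1
  · refine sum_congr (by ext; simp) fun σ _ => ?_
    rw [exp_hamiltonian G β hF hG]
    unfold sp
    ring
  · refine sum_congr (by ext; simp) fun σ _ => ?_
    rw [exp_hamiltonian G β hF hG]

end Convert

section NearestNeighbour
variable {d : ℕ} {R : Type*} [Ring R]

/-- This is where `r ≥ 3` enters: with period `2` the steps from `x` and from `x + e_i` would give
the same edge, and the Cayley graph would have double edges. -/
theorem edge_injective (h1 : (1 : R) ≠ 0) (h2 : (2 : R) ≠ 0) {x x' : Fin d → R} {i j : Fin d}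
    (h : s(x, x + Pi.single i 1) = s(x', x' + Pi.single j 1)) : x = x' ∧ i = j := by
  rw [Sym2.eq_iff] at h
  rcases h with ⟨rfl, h⟩ | ⟨h, h'⟩
  · refine ⟨rfl, ?_⟩
    by_contra hij
    have := congrFun (add_left_cancel h) i
    rw [Pi.single_eq_same, Pi.single_eq_of_ne hij] at this
    exact h1 this
  · exfalso
    have h3 : (Pi.single j 1 + Pi.single i 1 : Fin d → R) = 0 := by
      rw [h, add_assoc] at h'
      exact add_eq_left.1 h'
    have h4 := congrFun h3 i
    by_cases hij : i = j
    · subst hij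
      rw [Pi.add_apply, Pi.single_eq_same, Pi.zero_apply, one_add_one_eq_two] at h4
      exact h2 h4
    · rw [Pi.add_apply, Pi.single_eq_same, Pi.single_eq_of_ne hij, zero_add] at h4
      exact h1 h4

theorem nearestNeighbour_adj (h1 : (1 : R) ≠ 0) {x y : Fin d → R} :
    (nearestNeighbour d R).Adj x y ↔
      ∃ i, y = x + Pi.single i 1 ∨ x = y + Pi.single i 1 := by
  unfold nearestNeighbour
  rw [SimpleGraph.fromRel_adj]
  constructor
  · rintro ⟨-, ⟨i, h⟩ | ⟨i, h⟩⟩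
    · exact ⟨i, Or.inl h⟩
    · exact ⟨i, Or.inr h⟩
  · have hne : ∀ (z : Fin d → R) i, z ≠ z + Pi.single i 1 := by
      intro z i h
      have := congrFun (left_eq_add.1 h) i
      rw [Pi.single_eq_same] at this
      exact h1 this
    rintro ⟨i, rfl | rfl⟩
    · exact ⟨hne _ _, Or.inl ⟨i, rfl⟩⟩
    · exact ⟨(hne _ _).symm, Or.inr ⟨i, rfl⟩⟩

theorem zmod_two_ne_zero {r : ℕ} (hr : 3 ≤ r) : (2 : ZMod r) ≠ 0 := by
  intro h
  have : ((2 : ℕ) : ZMod r) = 0 := by exact_mod_cast h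
  rw [ZMod.natCast_eq_zero_iff] at this
  have := Nat.le_of_dvd (by norm_num) this
  omega

theorem zmod_one_ne_zero {r : ℕ} (hr : 3 ≤ r) : (1 : ZMod r) ≠ 0 := by
  intro h
  exact zmod_two_ne_zero hr (by rw [← one_add_one_eq_two, h, add_zero])

theorem torusTwoPoint_eq {r : ℕ} [NeZero r] (hr : 3 ≤ r) (β : ℝ) (x : Fin d → ZMod r) :
    torusTwoPoint d r β x =
      cayley (B := Tor fun _ : Fin d => r) (unitVec fun _ => r) (Real.tanh β) univ 0 x := by
  unfold torusTwoPoint cayley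
  refine twoPoint_eq_corr _ β ?_ ?_ 0 x
  · rintro ⟨y, i⟩ _ ⟨y', i'⟩ _ h
    obtain ⟨rfl, rfl⟩ := edge_injective (zmod_one_ne_zero hr) (zmod_two_ne_zero hr) h
    rfl
  · intro e
    induction e with
    | _ y z =>
      rw [SimpleGraph.mem_edgeSet, nearestNeighbour_adj (zmod_one_ne_zero hr)]
      constructor
      · rintro ⟨i, rfl | rfl⟩
        · exact ⟨(y, i), mem_univ _, rfl⟩
        · exact ⟨(z, i), mem_univ _, Sym2.eq_swap⟩
      · rintro ⟨⟨w, i⟩, -, h⟩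
        rw [Sym2.eq_iff] at h
        rcases h with ⟨rfl, rfl⟩ | ⟨rfl, rfl⟩
        · exact ⟨i, Or.inl rfl⟩
        · exact ⟨i, Or.inr rfl⟩

end NearestNeighbour

section Box
variable {d : ℕ}

theorem mem_box_iff {R : ℕ} {z : Fin d → ℤ} :
    z ∈ box d R ↔ ∀ i, -(R : ℤ) ≤ 2 * z i ∧ 2 * z i < R := by
  unfold IsingTorus.box
  simp only [Fintype.mem_piFinset, mem_Ico]
  refine forall_congr' fun i => ?_
  omega

theorem box_mono {R S : ℕ} (h : R ≤ S) : box d R ⊆ box d S := by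
  intro z
  simp only [mem_box_iff]
  intro hz i
  have := hz i
  omega

theorem zero_mem_box {R : ℕ} (h : 0 < R) : (0 : Fin d → ℤ) ∈ box d R := by
  rw [mem_box_iff]
  intro i
  simp only [Pi.zero_apply]
  omega

/-- The lattice edges of the box. -/
noncomputable def latEdges (d R : ℕ) : Finset ((Fin d → ℤ) × Fin d) :=
  (box d R ×ˢ univ).filter fun p => p.1 + Pi.single p.2 1 ∈ box d R

theorem mem_latEdges {R : ℕ} {p : (Fin d → ℤ) × Fin d} :
    p ∈ latEdges d R ↔ p.1 ∈ box d R ∧ p.1 + Pi.single p.2 1 ∈ box d R := by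
  simp [latEdges]

theorem latEdges_mono {R S : ℕ} (h : R ≤ S) : latEdges d R ⊆ latEdges d S := by
  intro p
  simp only [mem_latEdges]
  exact fun hp => ⟨box_mono h hp.1, box_mono h hp.2⟩

/-- The edges of the box as edges of a torus. -/
noncomputable def boxEdges (N : Fin d → ℕ) (R : ℕ) [∀ i, NeZero (N i)] : Finset (Tor N × Fin d) :=
  (latEdges d R).image fun p => (castTor N p.1, p.2)

theorem castTor_injOn {N : Fin d → ℕ} {R : ℕ} (hN : ∀ i, R ≤ N i) :
    Set.InjOn (castTor N) (box d R : Finset (Fin d → ℤ)) := by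
  intro z hz w hw h
  rw [mem_coe, mem_box_iff] at hz hw
  rw [← sub_eq_zero, ← map_sub, castTor_eq_zero] at h
  ext i
  have h1 := hz i
  have h2 := hw i
  have h3 := hN i
  have h4 := Int.eq_zero_of_abs_lt_dvd (h i) (by
    rw [Pi.sub_apply, abs_lt]; omega)
  rw [Pi.sub_apply] at h4
  omega

theorem boxTwoPoint_eq {R : ℕ} (β : ℝ) {N : Fin d → ℕ} [∀ i, NeZero (N i)] (hN : ∀ i, R ≤ N i)
    {x y : Fin d → ℤ} (hx : x ∈ box d R) (hy : y ∈ box d R) :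
    boxTwoPoint d R β x y =
      cayley (unitVec N) (Real.tanh β) (boxEdges N R) (castTor N x) (castTor N y) := by
  classical
  unfold boxTwoPoint
  rw [dif_pos ⟨hx, hy⟩]
  -- The value off the box is irrelevant: every edge in `latEdges` has both end points in the box.
  let cl : (Fin d → ℤ) → {z | z ∈ box d R} := fun z => if h : z ∈ box d R then ⟨z, h⟩ else ⟨x, hx⟩
  have hcl : ∀ z ∈ box d R, ((cl z : {z | z ∈ box d R}) : Fin d → ℤ) = z := by
    intro z hz
    simp only [cl, dif_pos hz]
  have hcl' : ∀ z (hz : z ∈ box d R), cl z = ⟨z, hz⟩ := fun z hz => Subtype.ext (hcl z hz)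
  have h1 : twoPoint ((nearestNeighbour d ℤ).induce {z | z ∈ box d R}) β ⟨x, hx⟩ ⟨y, hy⟩ =
      corr (fun p : (Fin d → ℤ) × Fin d => cl p.1) (fun p => cl (p.1 + Pi.single p.2 1))
        (Real.tanh β) (latEdges d R) ⟨x, hx⟩ ⟨y, hy⟩ := by
    refine twoPoint_eq_corr _ β ?_ ?_ _ _
    · rintro ⟨z, i⟩ hz ⟨w, j⟩ hw h
      rw [mem_coe, mem_latEdges] at hz hw
      have h' := congrArg (Sym2.map Subtype.val) h
      simp only [Sym2.map_mk, hcl _ hz.1, hcl _ hz.2, hcl _ hw.1, hcl _ hw.2] at h'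
      obtain ⟨rfl, rfl⟩ := edge_injective one_ne_zero two_ne_zero h'
      rfl
    · intro e
      induction e with
      | _ u v =>
        obtain ⟨u, hu⟩ := u
        obtain ⟨v, hv⟩ := v
        rw [SimpleGraph.mem_edgeSet, SimpleGraph.comap_adj]
        change (nearestNeighbour d ℤ).Adj u v ↔ _
        rw [nearestNeighbour_adj one_ne_zero]
        constructor
        · rintro ⟨i, rfl | rfl⟩
          · exact ⟨(u, i), mem_latEdges.2 ⟨hu, hv⟩, by simp only [hcl' _ hu, hcl' _ hv]⟩
          · exact ⟨(v, i), mem_latEdges.2 ⟨hv, hu⟩, by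
              simp only [hcl' _ hu, hcl' _ hv]; exact Sym2.eq_swap⟩
        · rintro ⟨⟨w, i⟩, hw, h⟩
          rw [mem_latEdges] at hw
          simp only [hcl' _ hw.1, hcl' _ hw.2] at h
          rw [Sym2.eq_iff, Subtype.ext_iff, Subtype.ext_iff, Subtype.ext_iff, Subtype.ext_iff] at h
          simp only at h
          rcases h with ⟨rfl, rfl⟩ | ⟨rfl, rfl⟩
          · exact ⟨i, Or.inl rfl⟩
          · exact ⟨i, Or.inr rfl⟩
  have hinj := castTor_injOn (d := d) hN
  have hφ : Function.Injective fun z : {z | z ∈ box d R} => castTor N z := fun z w h =>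
    Subtype.ext (hinj z.2 w.2 h)
  have h2 := corr_embed (a := fun p : Tor N × Fin d => p.1) (b := fun p => p.1 + unitVec N p.2)
    (a' := fun p : (Fin d → ℤ) × Fin d => cl p.1) (b' := fun p => cl (p.1 + Pi.single p.2 1))
    hφ (F := latEdges d R) (j := fun p => (castTor N p.1, p.2)) (by
      rintro ⟨z, i⟩ hz ⟨w, j⟩ hw h
      rw [mem_coe, mem_latEdges] at hz hw
      obtain ⟨h3, h4⟩ := Prod.mk.inj h
      exact Prod.ext (hinj hz.1 hw.1 h3) h4) (by
      intro p hp
      rw [mem_latEdges] at hp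
      refine Or.inl ⟨by simp only [hcl _ hp.1], ?_⟩
      simp only [hcl _ hp.2, map_add, castTor_single]) (Real.tanh β) ⟨x, hx⟩ ⟨y, hy⟩
  rw [h1, ← h2]
  rfl

theorem tanh_bounds {β : ℝ} (hβ : 0 < β) : 0 ≤ Real.tanh β ∧ Real.tanh β < 1 := by
  have hc := Real.cosh_pos β
  rw [Real.tanh_eq_sinh_div_cosh]
  refine ⟨div_nonneg (Real.sinh_pos_iff.2 hβ).le hc.le, ?_⟩
  rw [div_lt_one hc]
  exact Real.sinh_lt_cosh β

variable {β : ℝ} (hβ : 0 < β)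
include hβ

theorem boxTwoPoint_bounds (R : ℕ) (x y : Fin d → ℤ) :
    0 ≤ boxTwoPoint d R β x y ∧ boxTwoPoint d R β x y ≤ 1 := by
  obtain ⟨ht0, ht1⟩ := tanh_bounds hβ
  by_cases h : x ∈ box d R ∧ y ∈ box d R
  -- Any period at least `R` would do; `R + 1` is nonzero even when `R = 0`.
  · have : ∀ _ : Fin d, NeZero (R + 1) := fun _ => ⟨by omega⟩
    rw [boxTwoPoint_eq β (N := fun _ => R + 1) (fun _ => by omega) h.1 h.2]
    exact ⟨corr_nonneg ht0 ht1 _ _ _, corr_le_one ht0 ht1 _ _ _⟩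
  · simp [boxTwoPoint, dif_neg h]

theorem boxTwoPoint_mono (x y : Fin d → ℤ) : Monotone fun R => boxTwoPoint d R β x y := by
  obtain ⟨ht0, ht1⟩ := tanh_bounds hβ
  intro R S hRS
  by_cases h : x ∈ box d R ∧ y ∈ box d R
  · have : ∀ _ : Fin d, NeZero (S + 1) := fun _ => ⟨by omega⟩
    dsimp only
    rw [boxTwoPoint_eq β (N := fun _ => S + 1) (fun _ => by omega) h.1 h.2,
      boxTwoPoint_eq β (N := fun _ => S + 1) (fun _ => by omega) (box_mono hRS h.1)
        (box_mono hRS h.2)]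
    exact corr_mono ht0 ht1 (image_subset_image (latEdges_mono hRS)) _ _
  · have h0 : boxTwoPoint d R β x y = 0 := by simp [boxTwoPoint, dif_neg h]
    dsimp only
    rw [h0]
    exact (boxTwoPoint_bounds hβ S x y).1

theorem tendsto_boxTwoPoint (x : Fin d → ℤ) :
    Filter.Tendsto (fun R => boxTwoPoint d R β 0 x) Filter.atTop (nhds (bulkTwoPoint d β x)) := by
  have h := tendsto_atTop_ciSup (boxTwoPoint_mono hβ (0 : Fin d → ℤ) x)
    ⟨1, by rintro _ ⟨R, rfl⟩; exact (boxTwoPoint_bounds hβ R 0 x).2⟩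
  exact tendsto_nhds_limUnder ⟨_, h⟩

theorem boxTwoPoint_le_bulk (R : ℕ) (x : Fin d → ℤ) :
    boxTwoPoint d R β 0 x ≤ bulkTwoPoint d β x :=
  (boxTwoPoint_mono hβ 0 x).ge_of_tendsto (tendsto_boxTwoPoint hβ x) R

theorem bulk_nonneg (x : Fin d → ℤ) : 0 ≤ bulkTwoPoint d β x :=
  (boxTwoPoint_bounds hβ 0 0 x).1.trans (boxTwoPoint_le_bulk hβ 0 x)

theorem bulk_zero : bulkTwoPoint d β 0 = 1 := by
  obtain ⟨ht0, ht1⟩ := tanh_bounds hβ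
  refine tendsto_nhds_unique (tendsto_boxTwoPoint hβ 0) ?_
  refine tendsto_const_nhds.congr' ?_
  filter_upwards [Filter.eventually_gt_atTop 0] with R hR
  have : NeZero R := ⟨by omega⟩
  rw [boxTwoPoint_eq β (N := fun _ : Fin d => R) (fun _ => le_rfl) (zero_mem_box hR) (zero_mem_box hR)]
  exact (corr_self ht0 ht1 _ _).symm

end Box

end IsingCover

/-! ### Positivity of the lattice two-point function, box boundaries and periodisation. -/

namespace IsingCover

open Finset IsingTorus

section Positivity
variable {V ι : Type*} [Fintype V] [DecidableEq V] {a b : ι → V}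

theorem le_corr_of_joins {t : ℝ} (ht0 : 0 ≤ t) (ht1 : t < 1) {F : Finset ι} {i : ι} (hi : i ∈ F)
    {x y : V} (h : Joins a b i x y) : t ≤ corr a b t F x y := by
  classical
  by_cases hxy : x = y
  · rw [hxy, corr_self ht0 ht1]; exact ht1.le
  have h0 : corr a b t ∅ x y = 0 := by
    rw [corr_eq_of_isolated ht0 ht1 (by simp), if_neg hxy]
  have h1 := corr_insert_mul (F := ∅) ht0 ht1 (notMem_empty i) h y
  rw [h0, corr_self ht0 ht1] at h1
  have h2 : corr a b t (insert i (∅ : Finset ι)) x y = t := by linarith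
  have hs : insert i (∅ : Finset ι) ⊆ F := insert_subset hi (empty_subset F)
  exact h2.ge.trans (corr_mono ht0 ht1 hs x y)

end Positivity

section Lattice
variable {d : ℕ}

theorem eventually_mem_box (z : Fin d → ℤ) : ∀ᶠ R in Filter.atTop, z ∈ box d R := by
  filter_upwards [Filter.eventually_gt_atTop (∑ i, 2 * (z i).natAbs)] with R hR
  rw [mem_box_iff]
  intro i
  have : 2 * (z i).natAbs ≤ ∑ i, 2 * (z i).natAbs :=
    single_le_sum (f := fun i => 2 * (z i).natAbs) (fun _ _ => Nat.zero_le _) (mem_univ i)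
  omega

/-- The points of the box with a neighbour outside. -/
noncomputable def bdry (d R : ℕ) : Finset (Fin d → ℤ) :=
  (box d R).filter fun z => ∃ i, z + Pi.single i 1 ∉ box d R ∨ z - Pi.single i 1 ∉ box d R

theorem eventually_notMem_bdry (z : Fin d → ℤ) : ∀ᶠ R in Filter.atTop, z ∉ bdry d R := by
  have h1 : ∀ᶠ R in Filter.atTop, ∀ i : Fin d, z + Pi.single i 1 ∈ box d R :=
    Filter.eventually_all.2 fun i => eventually_mem_box _
  have h2 : ∀ᶠ R in Filter.atTop, ∀ i : Fin d, z - Pi.single i 1 ∈ box d R :=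
    Filter.eventually_all.2 fun i => eventually_mem_box _
  filter_upwards [h1, h2] with R h1 h2 h
  obtain ⟨-, i, h | h⟩ := mem_filter.1 h
  · exact h (h1 i)
  · exact h (h2 i)

theorem eventually_sum_bdry_lt {f : (Fin d → ℤ) → ℝ} (hf : Summable f) {ε : ℝ} (hε : 0 < ε) :
    ∀ᶠ R in Filter.atTop, ∑ z ∈ bdry d R, f z < ε := by
  obtain ⟨s, hs⟩ := summable_iff_vanishing_norm.1 hf ε hε
  have h : ∀ᶠ R in Filter.atTop, ∀ z ∈ s, z ∉ bdry d R :=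
    (Filter.eventually_all_finset s).2 fun z _ => eventually_notMem_bdry z
  filter_upwards [h] with R hR
  refine lt_of_le_of_lt (Real.le_norm_self _) (hs _ ?_)
  rw [Finset.disjoint_left]
  exact fun z hz hz' => hR z hz' hz

variable {β : ℝ} (hβ : 0 < β)
include hβ

/-- Positivity propagates along lattice edges by the product inequality, and every point is reached
one coordinate at a time. It is needed when `T` is infinite somewhere, to rule out a product `∞ ·
0`. -/
theorem bulk_pos (z : Fin d → ℤ) : 0 < bulkTwoPoint d β z := by
  obtain ⟨ht0, ht1⟩ := tanh_bounds hβ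
  have htp : 0 < Real.tanh β := by
    rw [Real.tanh_eq_sinh_div_cosh]
    exact div_pos (Real.sinh_pos_iff.2 hβ) (Real.cosh_pos β)
  have key : ∀ (z w : Fin d → ℤ) (i : Fin d), (w = z + Pi.single i 1 ∨ z = w + Pi.single i 1) →
      0 < bulkTwoPoint d β z → 0 < bulkTwoPoint d β w := by
    intro z w i hzw hz
    have h1 := (tendsto_boxTwoPoint hβ z).eventually (lt_mem_nhds hz)
    obtain ⟨R, h1, h2, h3, h4⟩ := (h1.and ((eventually_mem_box z).and ((eventually_mem_box w).and
      (Filter.eventually_gt_atTop 0)))).exists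
    refine lt_of_lt_of_le ?_ (boxTwoPoint_le_bulk hβ R w)
    have : NeZero R := ⟨by omega⟩
    rw [boxTwoPoint_eq β (N := fun _ : Fin d => R) (fun _ => le_rfl) (zero_mem_box h4) h2] at h1
    rw [boxTwoPoint_eq β (N := fun _ : Fin d => R) (fun _ => le_rfl) (zero_mem_box h4) h3]
    refine lt_of_lt_of_le (mul_pos h1 ?_) (corr_mul_corr_le ht0 ht1 _ _ (castTor _ z) _)
    refine lt_of_lt_of_le htp ?_
    rcases hzw with rfl | rfl
    · refine le_corr_of_joins ht0 ht1 (i := (castTor _ z, i))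
        (mem_image.2 ⟨(z, i), mem_latEdges.2 ⟨h2, h3⟩, rfl⟩) (Or.inl ⟨rfl, ?_⟩)
      rw [map_add, castTor_single]
    · refine le_corr_of_joins ht0 ht1 (i := (castTor _ w, i))
        (mem_image.2 ⟨(w, i), mem_latEdges.2 ⟨h3, h2⟩, rfl⟩) (Or.inr ⟨rfl, ?_⟩)
      rw [map_add, castTor_single]
  have line : ∀ (w : Fin d → ℤ) (i : Fin d) (k : ℤ), 0 < bulkTwoPoint d β w →
      0 < bulkTwoPoint d β (Pi.single i k + w) := by
    intro w i k hw
    induction k using Int.induction_on with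
    | zero => simpa using hw
    | succ n ih =>
      refine key _ _ i (Or.inl ?_) ih
      rw [Pi.single_add]; abel
    | pred n ih =>
      refine key _ _ i (Or.inr ?_) ih
      rw [Pi.single_sub]; abel
  have h : ∀ s : Finset (Fin d), 0 < bulkTwoPoint d β (∑ i ∈ s, Pi.single i (z i)) := by
    intro s
    induction s using Finset.induction_on with
    | empty => rw [sum_empty, bulk_zero hβ]; exact one_pos
    | insert i s hi ih => rw [sum_insert hi]; exact line _ i _ ih
  simpa [univ_sum_single] using h univ

omit hβ in
theorem torusT_eq_tsum {r : ℕ} [NeZero r] (x : Fin d → ZMod r) :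
    torusT d r β x = ∑' z : Fin d → ℤ, if castTor (fun _ => r) z = x then
      ENNReal.ofReal (bulkTwoPoint d β z) else 0 := by
  have hrep : castTor (fun _ : Fin d => r) (rep x) = x := funext fun i => cast_rep x i
  have hr : (r : ℤ) ≠ 0 := by exact_mod_cast NeZero.ne r
  have hcast : ∀ u : Fin d → ℤ, castTor (fun _ : Fin d => r) (rep x + (r : ℤ) • u) = x := by
    intro u
    rw [map_add, hrep, add_eq_left, castTor_eq_zero]
    exact fun i => ⟨u i, rfl⟩
  have hinj : Function.Injective fun u : Fin d → ℤ => rep x + (r : ℤ) • u := by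
    intro u v huv
    have h1 := add_left_cancel huv
    ext i
    have := congrFun h1 i
    exact mul_left_cancel₀ hr (by simpa only [Pi.smul_apply, smul_eq_mul] using this)
  unfold torusT periodised
  rw [← hinj.tsum_eq (f := fun z => if castTor (fun _ : Fin d => r) z = x then
      ENNReal.ofReal (bulkTwoPoint d β z) else 0)]
  · refine tsum_congr fun u => ?_
    rw [if_pos (hcast u)]
  · intro z hz
    have h1 : castTor (fun _ : Fin d => r) z = x := by
      by_contra h
      exact hz (if_neg h)
    have h2 : castTor (fun _ : Fin d => r) (z - rep x) = 0 := by rw [map_sub, h1, hrep, sub_self]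
    rw [castTor_eq_zero] at h2
    choose u hu using h2
    refine ⟨u, ?_⟩
    ext i
    have := hu i
    simp only [Pi.sub_apply] at this
    simp only [Pi.add_apply, Pi.smul_apply, smul_eq_mul]
    linarith

end Lattice

/-! ### Comparison of fibre sums on a torus with the periodised lattice function. -/

section Comparison
variable {d r : ℕ} [NeZero r] {β : ℝ} (hβ : 0 < β)
include hβ

theorem sum_bulk_le {x : Fin d → ZMod r} (hx : torusT d r β x ≠ ⊤) (s : Finset (Fin d → ℤ)) :
    ∑ z ∈ s with castTor (fun _ => r) z = x, bulkTwoPoint d β z ≤ (torusT d r β x).toReal := by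
  rw [← ENNReal.ofReal_le_iff_le_toReal hx, torusT_eq_tsum,
    ENNReal.ofReal_sum_of_nonneg fun z _ => bulk_nonneg hβ z, sum_filter]
  exact ENNReal.sum_le_tsum s

theorem torusT_le {x : Fin d → ZMod r} {c : ℝ}
    (h : ∀ s : Finset (Fin d → ℤ),
      ∑ z ∈ s with castTor (fun _ => r) z = x, bulkTwoPoint d β z ≤ c) :
    torusT d r β x ≤ ENNReal.ofReal c := by
  rw [torusT_eq_tsum, ENNReal.tsum_eq_iSup_sum]
  refine iSup_le fun s => ?_
  rw [← sum_filter, ← ENNReal.ofReal_sum_of_nonneg fun z _ => bulk_nonneg hβ z]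
  exact ENNReal.ofReal_le_ofReal (h s)

theorem summable_bulk (hT : ∀ x : Fin d → ZMod r, torusT d r β x ≠ ⊤) :
    Summable (bulkTwoPoint d β) := by
  refine summable_of_sum_le (c := ∑ x : Fin d → ZMod r, (torusT d r β x).toReal)
    (fun z => bulk_nonneg hβ z) fun s => ?_
  rw [← sum_fiberwise_of_maps_to (t := univ) (g := castTor fun _ : Fin d => r) fun _ _ => mem_univ _]
  exact sum_le_sum fun x _ => sum_bulk_le hβ (hT x) s

variable {N : Fin d → ℕ} [∀ i, NeZero (N i)]

omit hβ [NeZero r] [∀ i, NeZero (N i)] in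
theorem castTor_proj (h : ∀ i, r ∣ N i) (z : Fin d → ℤ) :
    proj (M := fun _ : Fin d => r) h (castTor N z) = castTor (fun _ => r) z := proj_castTor _ z

-- The box embeds in the torus, compatibly with reduction modulo `r`, and adding the remaining torus
-- edges increases correlations.
omit [NeZero r] in
theorem sum_boxTwoPoint_le (h : ∀ i, r ∣ N i) {R : ℕ} (hR : ∀ i, R ≤ N i) (hR0 : 0 < R)
    (s : Finset (Fin d → ℤ)) (x : Fin d → ZMod r) :
    ∑ z ∈ s with castTor (fun _ => r) z = x, boxTwoPoint d R β 0 z ≤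
      torSum (Real.tanh β) h x := by
  obtain ⟨ht0, ht1⟩ := tanh_bounds hβ
  have hinj := castTor_injOn (d := d) hR
  calc ∑ z ∈ s with castTor (fun _ => r) z = x, boxTwoPoint d R β 0 z
      = ∑ z ∈ (s.filter fun z => castTor (fun _ => r) z = x).filter (· ∈ box d R),
          boxTwoPoint d R β 0 z := by
        rw [sum_filter (· ∈ box d R)]
        refine sum_congr rfl fun z _ => ?_
        split_ifs with hz
        · rfl
        · simp [boxTwoPoint, hz]
    _ = ∑ c ∈ ((s.filter fun z => castTor (fun _ => r) z = x).filter (· ∈ box d R)).image (castTor N),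
          cayley (unitVec N) (Real.tanh β) (boxEdges N R) 0 c := by
        rw [sum_image]
        · refine sum_congr rfl fun z hz => ?_
          rw [boxTwoPoint_eq β hR (zero_mem_box hR0) (mem_filter.1 hz).2, map_zero]
        · intro z hz w hw
          exact hinj (mem_filter.1 hz).2 (mem_filter.1 hw).2
    _ ≤ ∑ c ∈ ((s.filter fun z => castTor (fun _ => r) z = x).filter (· ∈ box d R)).image (castTor N),
          cayley (unitVec N) (Real.tanh β) univ 0 c :=
        sum_le_sum fun c _ => corr_mono ht0 ht1 (subset_univ _) _ _
    _ ≤ torSum (Real.tanh β) h x := by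
        refine sum_le_sum_of_subset_of_nonneg ?_ fun c _ _ => cayley_nonneg ht0 ht1 _ _ _ _
        intro c hc
        obtain ⟨z, hz, rfl⟩ := mem_image.1 hc
        rw [mem_filter]
        exact ⟨mem_univ _, (castTor_proj h z).trans (mem_filter.1 (mem_filter.1 hz).1).2⟩

theorem exists_of_cayley_boxEdges_ne_zero {R : ℕ} (hR0 : 0 < R) {c : Tor N}
    (hc : cayley (unitVec N) (Real.tanh β) (boxEdges N R) 0 c ≠ 0) :
    ∃ z ∈ box d R, castTor N z = c := by
  obtain ⟨ht0, ht1⟩ := tanh_bounds hβ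
  by_contra hne
  push Not at hne
  apply hc
  unfold cayley
  rw [corr_comm, corr_eq_of_isolated ht0 ht1, if_neg]
  · intro h0
    exact hne 0 (zero_mem_box hR0) (by rw [map_zero, h0])
  · intro p hp
    obtain ⟨q, hq, rfl⟩ := mem_image.1 hp
    rw [mem_latEdges] at hq
    refine ⟨hne _ hq.1, ?_⟩
    have := hne _ hq.2
    rwa [map_add, castTor_single] at this

theorem sum_cayley_box_le (h : ∀ i, r ∣ N i) {R : ℕ} (hR : ∀ i, R ≤ N i) (hR0 : 0 < R)
    {x : Fin d → ZMod r} (hx : torusT d r β x ≠ ⊤) :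
    ∑ c with proj (M := fun _ : Fin d => r) h c = x,
      cayley (unitVec N) (Real.tanh β) (boxEdges N R) 0 c ≤ (torusT d r β x).toReal := by
  obtain ⟨ht0, ht1⟩ := tanh_bounds hβ
  have hinj := castTor_injOn (d := d) hR
  refine le_trans ?_ (sum_bulk_le hβ hx (box d R))
  rw [← sum_filter_ne_zero]
  calc _ ≤ ∑ c ∈ ((box d R).filter fun z => castTor (fun _ => r) z = x).image (castTor N),
          cayley (unitVec N) (Real.tanh β) (boxEdges N R) 0 c := by
        refine sum_le_sum_of_subset_of_nonneg ?_ fun c _ _ => cayley_nonneg ht0 ht1 _ _ _ _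
        intro c hc
        obtain ⟨hc1, hc2⟩ := mem_filter.1 hc
        obtain ⟨z, hz, rfl⟩ := exists_of_cayley_boxEdges_ne_zero hβ hR0 hc2
        refine mem_image.2 ⟨z, mem_filter.2 ⟨hz, ?_⟩, rfl⟩
        rw [← castTor_proj h]
        exact (mem_filter.1 hc1).2
    _ = ∑ z ∈ (box d R).filter fun z => castTor (fun _ => r) z = x, boxTwoPoint d R β 0 z := by
        rw [sum_image]
        · refine sum_congr rfl fun z hz => ?_
          rw [boxTwoPoint_eq β hR (zero_mem_box hR0) (mem_filter.1 hz).1, map_zero]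
        · intro z hz w hw
          exact hinj (mem_filter.1 hz).1 (mem_filter.1 hw).1
    _ ≤ _ := sum_le_sum fun z _ => boxTwoPoint_le_bulk hβ R z

/-- The shift `v` selects one of the two end points of an edge. A nonzero term has that end point in
the box and hence, the edge not being a box edge, in its boundary. Each boundary point occurs at
most once per direction. -/
theorem sum_bdry_le {R : ℕ} (hR : ∀ i, R ≤ N i) (hR0 : 0 < R) (v : Fin d → Tor N)
    (hv : ∀ c i, (c - v i, i) ∉ boxEdges N R → ∀ z ∈ box d R, castTor N z = c → z ∈ bdry d R) :
    ∑ p ∈ univ \ boxEdges N R,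
      cayley (unitVec N) (Real.tanh β) (boxEdges N R) 0 (p.1 + v p.2) ≤
      d * ∑ z ∈ bdry d R, bulkTwoPoint d β z := by
  obtain ⟨ht0, ht1⟩ := tanh_bounds hβ
  have hinj := castTor_injOn (d := d) hR
  have hsub : bdry d R ⊆ box d R := filter_subset _ _
  rw [← sum_filter_ne_zero]
  calc _ ≤ ∑ p ∈ (bdry d R ×ˢ univ).image fun q : (Fin d → ℤ) × Fin d => (castTor N q.1 - v q.2, q.2),
          cayley (unitVec N) (Real.tanh β) (boxEdges N R) 0 (p.1 + v p.2) := by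
        refine sum_le_sum_of_subset_of_nonneg ?_ fun c _ _ => cayley_nonneg ht0 ht1 _ _ _ _
        rintro ⟨c, i⟩ hp
        obtain ⟨hp1, hp2⟩ := mem_filter.1 hp
        obtain ⟨z, hz, hzc⟩ := exists_of_cayley_boxEdges_ne_zero hβ hR0 hp2
        have hnot := (mem_sdiff.1 hp1).2
        simp only at hzc
        have hb := hv (c + v i) i (by simpa using hnot) z hz hzc
        refine mem_image.2 ⟨(z, i), mem_product.2 ⟨hb, mem_univ _⟩, ?_⟩
        simp [hzc]
    _ = ∑ q ∈ bdry d R ×ˢ (univ : Finset (Fin d)), boxTwoPoint d R β 0 q.1 := by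
        rw [sum_image]
        · refine sum_congr rfl fun q hq => ?_
          rw [boxTwoPoint_eq β hR (zero_mem_box hR0) (hsub (mem_product.1 hq).1), map_zero,
            sub_add_cancel]
        · rintro ⟨z, i⟩ hz ⟨w, j⟩ hw hzw
          obtain ⟨h1, h2⟩ := Prod.mk.inj hzw
          simp only at h2
          subst h2
          rw [mem_coe, mem_product] at hz hw
          exact Prod.ext (hinj (hsub hz.1) (hsub hw.1) (sub_left_injective h1)) rfl
    _ ≤ ∑ q ∈ bdry d R ×ˢ (univ : Finset (Fin d)), bulkTwoPoint d β q.1 :=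
        sum_le_sum fun q _ => boxTwoPoint_le_bulk hβ R q.1
    _ = _ := by
        rw [sum_product]
        simp [mul_sum]

/-- Lieb's inequality for the box inside the torus. The part staying in the box is at most `T`. The
rest passes through a boundary point, by one of `2 d` choices of direction and end point, and what
follows is at most the total torus sum. -/
theorem torSum_le_add (h : ∀ i, r ∣ N i) {R : ℕ} (hR : ∀ i, R ≤ N i) (hR0 : 0 < R)
    {x : Fin d → ZMod r} (hx : torusT d r β x ≠ ⊤) :
    torSum (Real.tanh β) h x ≤ (torusT d r β x).toReal +
      2 * d * (∑ z ∈ bdry d R, bulkTwoPoint d β z) * ∑ y, torSum (Real.tanh β) h y := by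
  obtain ⟨ht0, ht1⟩ := tanh_bounds hβ
  set t := Real.tanh β with ht
  set G := boxEdges N R with hG
  have hS0 : ∀ y, 0 ≤ torSum t h y := fun y => sumTau_nonneg ht0 ht1 _ _ _
  have hχ : ∀ b : Tor N, ∑ c with proj (M := fun _ : Fin d => r) h c = x,
      cayley (unitVec N) t univ b c ≤ ∑ y, torSum t h y := by
    intro b
    refine le_trans (le_of_eq ?_) (single_le_sum (fun y _ => hS0 y)
      (mem_univ (x - proj (M := fun _ : Fin d => r) h b)))
    simp only [cayley_translate (unitVec N) t b]
    unfold torSum sumTau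
    refine sum_bij (fun c _ => c - b) ?_ ?_ ?_ fun _ _ => rfl
    · intro c hc
      rw [mem_filter] at hc ⊢
      exact ⟨mem_univ _, by rw [map_sub, hc.2]⟩
    · intro c _ c' _ hcc; exact sub_left_injective hcc
    · intro c hc
      rw [mem_filter] at hc
      refine ⟨c + b, ?_, by simp⟩
      rw [mem_filter, map_add, hc.2]
      exact ⟨mem_univ _, sub_add_cancel _ _⟩
  have hχ0 : 0 ≤ ∑ y, torSum t h y := sum_nonneg fun y _ => hS0 y
  have hbd1 := sum_bdry_le hβ hR hR0 (fun _ => 0) (by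
    intro c i hc z hz hzc
    refine mem_filter.2 ⟨hz, i, Or.inl fun hz' => hc ?_⟩
    exact mem_image.2 ⟨(z, i), mem_latEdges.2 ⟨hz, hz'⟩, by simp [hzc]⟩)
  have hbd2 := sum_bdry_le hβ hR hR0 (unitVec N) (by
    intro c i hc z hz hzc
    refine mem_filter.2 ⟨hz, i, Or.inr fun hz' => hc ?_⟩
    refine mem_image.2 ⟨(z - Pi.single i 1, i), mem_latEdges.2 ⟨hz', by simpa using hz⟩, ?_⟩
    rw [map_sub, hzc, castTor_single])
  simp only [add_zero] at hbd1
  have hbox := sum_cayley_box_le hβ h hR hR0 hx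
  rw [← ht, ← hG] at hbd1 hbd2 hbox
  calc torSum t h x ≤ ∑ c with proj (M := fun _ : Fin d => r) h c = x,
        (cayley (unitVec N) t G 0 c + t * ∑ p ∈ univ \ G,
          (cayley (unitVec N) t G 0 p.1 * cayley (unitVec N) t univ (p.1 + unitVec N p.2) c +
          cayley (unitVec N) t G 0 (p.1 + unitVec N p.2) * cayley (unitVec N) t univ p.1 c)) :=
        sum_le_sum fun c _ => corr_le_of_subset ht0 ht1 c (subset_univ G) 0
    _ = ∑ c with proj (M := fun _ : Fin d => r) h c = x, cayley (unitVec N) t G 0 c +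
        t * ∑ p ∈ univ \ G, (cayley (unitVec N) t G 0 p.1 *
            ∑ c with proj (M := fun _ : Fin d => r) h c = x,
              cayley (unitVec N) t univ (p.1 + unitVec N p.2) c +
          cayley (unitVec N) t G 0 (p.1 + unitVec N p.2) *
            ∑ c with proj (M := fun _ : Fin d => r) h c = x, cayley (unitVec N) t univ p.1 c) := by
        rw [sum_add_distrib, ← mul_sum, sum_comm]
        congr 2
        refine sum_congr rfl fun p _ => ?_
        rw [sum_add_distrib, mul_sum, mul_sum]
    _ ≤ (torusT d r β x).toReal + 1 * ∑ p ∈ univ \ G, (cayley (unitVec N) t G 0 p.1 *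
            (∑ y, torSum t h y) +
          cayley (unitVec N) t G 0 (p.1 + unitVec N p.2) * ∑ y, torSum t h y) := by
        refine add_le_add hbox (mul_le_mul ht1.le (sum_le_sum fun p _ => add_le_add
          (mul_le_mul_of_nonneg_left (hχ _) (cayley_nonneg ht0 ht1 _ _ _ _))
          (mul_le_mul_of_nonneg_left (hχ _) (cayley_nonneg ht0 ht1 _ _ _ _)))
          (sum_nonneg fun p _ => add_nonneg ?_ ?_) zero_le_one)
        · exact mul_nonneg (cayley_nonneg ht0 ht1 _ _ _ _)
            (sum_nonneg fun _ _ => cayley_nonneg ht0 ht1 _ _ _ _)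
        · exact mul_nonneg (cayley_nonneg ht0 ht1 _ _ _ _)
            (sum_nonneg fun _ _ => cayley_nonneg ht0 ht1 _ _ _ _)
    _ = (torusT d r β x).toReal + (∑ p ∈ univ \ G, cayley (unitVec N) t G 0 p.1 +
          ∑ p ∈ univ \ G, cayley (unitVec N) t G 0 (p.1 + unitVec N p.2)) *
            ∑ y, torSum t h y := by
        rw [one_mul, sum_add_distrib, ← sum_mul, ← sum_mul, add_mul]
    _ ≤ _ := by
        have := mul_le_mul_of_nonneg_right (add_le_add hbd1 hbd2) hχ0
        linarith

end Comparison

/-! ### Passage from the dyadic tori to the lattice. -/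

section Dyadic
variable {d r : ℕ} [NeZero r] {β : ℝ} (hβ : 0 < β)
include hβ

/-- The sums `torSum` are bounded by the periodised two-point function of the lattice. -/
theorem torSum_le_torusT (hT : ∀ x : Fin d → ZMod r, torusT d r β x ≠ ⊤) (k : ℕ)
    (x : Fin d → ZMod r) :
    torSum (Real.tanh β) (N := fun _ => r * 2 ^ k) (dvd_dyadic k) x ≤
      (torusT d r β x).toReal := by
  obtain ⟨ht0, ht1⟩ := tanh_bounds hβ
  set χ := ∑ y : Fin d → ZMod r, (torusT d r β y).toReal with hχ
  have hχ0 : 0 ≤ χ := sum_nonneg fun _ _ => ENNReal.toReal_nonneg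
  set n : ℝ := (Fintype.card (Fin d → ZMod r) : ℝ) with hn
  have hn0 : 0 ≤ n := Nat.cast_nonneg _
  have hsum := summable_bulk hβ hT
  refine le_of_forall_pos_le_add fun ε hε => ?_
  -- The first bound makes `2 d n ψ ≤ 1/2`, so that the total torus sum can be absorbed. The second
  -- makes the final error `4 d ψ χ` at most `ε`.
  have hδ : 0 < min (1 / (2 * (2 * d * n + 1))) (ε / (4 * d * χ + 1)) := by positivity
  obtain ⟨R, hR, hR0⟩ := ((eventually_sum_bdry_lt hsum hδ).and
    (Filter.eventually_gt_atTop 0)).exists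
  set ψ := ∑ z ∈ bdry d R, bulkTwoPoint d β z with hψ
  have hψ0 : 0 ≤ ψ := sum_nonneg fun z _ => bulk_nonneg hβ z
  obtain ⟨hR1, hR2⟩ := lt_min_iff.1 hR
  rw [lt_div_iff₀ (by positivity)] at hR1 hR2
  -- The box need not fit in the torus at level `k`. Since the fibre sums increase with the level,
  -- it suffices to bound the one at level `k + R`, where it does fit.
  have hRk : R ≤ r * 2 ^ (k + R) := by
    have h1 : R < 2 ^ R := Nat.lt_two_pow_self
    have h2 : 2 ^ R ≤ 2 ^ (k + R) := Nat.pow_le_pow_right (by norm_num) (by omega)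
    have h3 : 1 ≤ r := Nat.pos_of_ne_zero (NeZero.ne r)
    nlinarith
  refine (dyadic_mono ht0 ht1 x (Nat.le_add_right k R)).trans ?_
  dsimp only
  have key : ∀ y, torSum (Real.tanh β) (N := fun _ : Fin d => r * 2 ^ (k + R))
      (dvd_dyadic (k + R)) y ≤ (torusT d r β y).toReal + 2 * d * ψ *
      ∑ w : Fin d → ZMod r, torSum (Real.tanh β) (N := fun _ => r * 2 ^ (k + R))
        (dvd_dyadic (k + R)) w := fun y =>
    torSum_le_add hβ (N := fun _ => r * 2 ^ (k + R)) (dvd_dyadic (k + R)) (fun _ => hRk) hR0 (hT y)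
  set Θ := ∑ w : Fin d → ZMod r, torSum (Real.tanh β) (N := fun _ => r * 2 ^ (k + R))
        (dvd_dyadic (k + R)) w with hΘ
  have hΘ0 : 0 ≤ Θ := sum_nonneg fun _ _ => sumTau_nonneg ht0 ht1 _ _ _
  -- Summing over all `x` bounds `Θ` in terms of itself; absorbing the last term gives `Θ ≤ 2 χ`.
  have h1 : Θ ≤ χ + n * (2 * d * ψ * Θ) := by
    calc Θ ≤ ∑ y : Fin d → ZMod r, ((torusT d r β y).toReal + 2 * d * ψ * Θ) :=
          sum_le_sum fun y _ => key y
      _ = _ := by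
          rw [sum_add_distrib, sum_const, nsmul_eq_mul, card_univ]
  have hd0 : (0 : ℝ) ≤ d := Nat.cast_nonneg _
  have h2 : n * (2 * d * ψ) ≤ 1 / 2 := by nlinarith
  have h3 : Θ ≤ 2 * χ := by nlinarith
  refine (key x).trans ?_
  have h4 : 2 * d * ψ * Θ ≤ 2 * d * ψ * (2 * χ) := mul_le_mul_of_nonneg_left h3 (by positivity)
  nlinarith

/-- The difference between the periodised two-point function of the lattice and the two-point
function of the torus, when the former is finite. -/
theorem torusT_toReal_sub_le (hr : 3 ≤ r) (hT : ∀ x : Fin d → ZMod r, torusT d r β x ≠ ⊤)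
    (x : Fin d → ZMod r) :
    (torusT d r β x).toReal - torusTwoPoint d r β x ≤
      2 * ((torusT d r β 0).toReal - 1) *
        ∑ w, (torusT d r β w).toReal * (torusT d r β (x - w)).toReal := by
  obtain ⟨ht0, ht1⟩ := tanh_bounds hβ
  set T : (Fin d → ZMod r) → ℝ := fun y => (torusT d r β y).toReal with hTdef
  have hτ := torusTwoPoint_eq (d := d) hr β x
  have hB : ∀ k, torSum (Real.tanh β) (N := fun _ => r * 2 ^ k) (dvd_dyadic k) x ≤
      torusTwoPoint d r β x + 2 * (T 0 - 1) * ∑ w, T w * T (x - w) := by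
    intro k
    have h1 := dyadic_bound (r := r) (d := d) ht0 ht1 k x
    have hle := torSum_le_torusT hβ hT k
    have h0 : ∀ y, 0 ≤ torSum (Real.tanh β) (N := fun _ : Fin d => r * 2 ^ k)
        (dvd_dyadic k) y := fun y => sumTau_nonneg ht0 ht1 _ _ _
    have hone : 1 ≤ torSum (Real.tanh β) (N := fun _ : Fin d => r * 2 ^ k) (dvd_dyadic k)
        (0 : Fin d → ZMod r) := one_le_sumTau ht0 ht1 _ _
    change torSum (Real.tanh β) (N := fun _ : Fin d => r * 2 ^ k) (dvd_dyadic k) x - _ ≤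
      2 * (torSum (Real.tanh β) (N := fun _ : Fin d => r * 2 ^ k) (dvd_dyadic k) 0 - 1) *
      ∑ w : Fin d → ZMod r, torSum (Real.tanh β) (N := fun _ : Fin d => r * 2 ^ k) (dvd_dyadic k) w *
        torSum (Real.tanh β) (N := fun _ : Fin d => r * 2 ^ k) (dvd_dyadic k) (x - w) at h1
    rw [← hτ] at h1
    have h2 : ∑ w : Fin d → ZMod r,
        torSum (Real.tanh β) (N := fun _ : Fin d => r * 2 ^ k) (dvd_dyadic k) w *
        torSum (Real.tanh β) (N := fun _ : Fin d => r * 2 ^ k) (dvd_dyadic k) (x - w) ≤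
        ∑ w, T w * T (x - w) :=
      sum_le_sum fun w _ => mul_le_mul (hle w) (hle _) (h0 _) ENNReal.toReal_nonneg
    have h3 : 0 ≤ ∑ w : Fin d → ZMod r,
        torSum (Real.tanh β) (N := fun _ : Fin d => r * 2 ^ k) (dvd_dyadic k) w *
        torSum (Real.tanh β) (N := fun _ : Fin d => r * 2 ^ k) (dvd_dyadic k) (x - w) :=
      sum_nonneg fun w _ => mul_nonneg (h0 _) (h0 _)
    have h4 := mul_le_mul (sub_le_sub_right (hle 0) 1) h2 h3 (sub_nonneg.2 (hone.trans (hle 0)))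
    change _ ≤ (T 0 - 1) * _ at h4
    linarith
  set c := torusTwoPoint d r β x + 2 * (T 0 - 1) * ∑ w, T w * T (x - w) with hc
  have hbox : ∀ s : Finset (Fin d → ℤ),
      ∑ z ∈ s with castTor (fun _ => r) z = x, bulkTwoPoint d β z ≤ c := by
    intro s
    -- The finite set `s` is fixed while the box grows. Level `R` of the tower holds a box of side
    -- `R`, and the bound `c` is the same at all levels.
    refine le_of_tendsto (tendsto_finsetSum _ fun z _ => tendsto_boxTwoPoint hβ z) ?_
    filter_upwards [Filter.eventually_gt_atTop 0] with R hR0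
    have hRk : R ≤ r * 2 ^ R := by
      have h1 : R < 2 ^ R := Nat.lt_two_pow_self
      have h3 : 1 ≤ r := Nat.pos_of_ne_zero (NeZero.ne r)
      nlinarith
    exact (sum_boxTwoPoint_le hβ (N := fun _ => r * 2 ^ R) (dvd_dyadic R) (fun _ => hRk) hR0
      s x).trans (hB R)
  have h1 := torusT_le hβ hbox
  have hc0 : 0 ≤ c := by
    have := hbox ∅
    simpa using this
  have h2 := ENNReal.toReal_le_of_le_ofReal hc0 h1
  linarith

end Dyadic

end IsingCover

/-! ### The inequality in the extended reals. -/

open IsingCover IsingTorus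

theorem corollary2p2 (d r : ℕ) [NeZero r] (hd : 1 ≤ d) (hr : 3 ≤ r) (β : ℝ) (hβ : 0 < β)
    (x : Fin d → ZMod r) :
    (IsingTorus.torusT d r β x : EReal) - ((IsingTorus.torusTwoPoint d r β x : ℝ) : EReal) ≤
      ((2 * IsingTorus.torusConv
        (IsingTorus.torusConv (IsingTorus.torusT d r β)
          (IsingTorus.torusT d r β ^ 2 * (IsingTorus.torusT d r β - IsingTorus.torusTau d r β)))
        (IsingTorus.torusT d r β) x : ℝ≥0∞) : EReal) := by
  set T := torusT d r β with hTdef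
  have hrep : (rep (0 : Fin d → ZMod r)) = 0 := by
    funext i; simp [rep]
  have hτ0 : torusTau d r β 0 = 1 := by
    unfold torusTau; rw [hrep, bulk_zero hβ, ENNReal.ofReal_one]
  have hT0 : 1 ≤ T 0 := hτ0 ▸ torusTau_le_torusT d r β 0
  set M := T ^ 2 * (T - torusTau d r β) with hM
  -- A single term bounds the double convolution from below. This suffices to show that it is
  -- infinite when `T` is infinite somewhere.
  have hconv : ∀ y z, T y * M z * T (x - (y + z)) ≤ torusConv (torusConv T M) T x := by
    intro y z
    unfold torusConv
    refine le_trans ?_ (Finset.single_le_sum (f := fun w => (∑ y, T y * M (w - y)) * T (x - w))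
      (fun _ _ => zero_le) (Finset.mem_univ (y + z)))
    refine mul_le_mul_left ?_ _
    refine le_trans (le_of_eq ?_) (Finset.single_le_sum (f := fun y' => T y' * M (y + z - y'))
      (fun _ _ => zero_le) (Finset.mem_univ y))
    simp only [add_sub_cancel_left]
  by_cases hfin : ∀ y, T y ≠ ⊤
  swap
  · push Not at hfin
    obtain ⟨z, hz⟩ := hfin
    have hMz : M z = ⊤ := by
      have : T z - torusTau d r β z = ⊤ := by
        rw [hz]; exact ENNReal.top_sub ENNReal.ofReal_ne_top
      change T z ^ 2 * (T z - torusTau d r β z) = ⊤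
      rw [this, hz]; simp
    have hpos : T (x - (0 + z)) ≠ 0 := by
      refine (lt_of_lt_of_le ?_ (torusTau_le_torusT d r β _)).ne'
      exact ENNReal.ofReal_pos.2 (bulk_pos hβ _)
    have htop : torusConv (torusConv T M) T x = ⊤ := by
      refine top_le_iff.1 (le_trans (le_of_eq ?_) (hconv 0 z))
      rw [hMz, ENNReal.mul_top (zero_lt_one.trans_le hT0).ne', ENNReal.top_mul hpos]
    rw [htop, ENNReal.mul_top two_ne_zero]
    exact le_top
  have key := torusT_toReal_sub_le hβ hr hfin x
  set B := 2 * ((T 0).toReal - 1) * ∑ w, (T w).toReal * (T (x - w)).toReal with hB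
  have h1 : (T 0).toReal - 1 = (T 0 - 1).toReal := by
    rw [ENNReal.toReal_sub_of_le hT0 (hfin 0), ENNReal.toReal_one]
  have hBle : ENNReal.ofReal B ≤ 2 * torusConv (torusConv T M) T x := by
    have e : ENNReal.ofReal B = 2 * ((T 0 - 1) * ∑ w, T w * T (x - w)) := by
      rw [hB, h1, mul_assoc, ENNReal.ofReal_mul zero_le_two, ENNReal.ofReal_mul ENNReal.toReal_nonneg,
        ENNReal.ofReal_toReal (ENNReal.sub_ne_top (hfin 0)),
        ENNReal.ofReal_sum_of_nonneg fun w _ => mul_nonneg ENNReal.toReal_nonneg ENNReal.toReal_nonneg]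
      congr 2
      · norm_num
      · congr 1
        funext w
        rw [← ENNReal.toReal_mul, ENNReal.ofReal_toReal (ENNReal.mul_ne_top (hfin _) (hfin _))]
    rw [e]
    refine mul_le_mul_right ?_ _
    unfold torusConv
    rw [Finset.mul_sum]
    refine Finset.sum_le_sum fun w _ => ?_
    rw [← mul_assoc]
    refine mul_le_mul_left ?_ _
    -- Only the value of the middle factor at `0` is kept; there `τ_β(0) = 1` and `T(0)² ≥ 1`.
    have hM0 : T 0 - 1 ≤ M 0 := by
      simp only [hM, Pi.mul_apply, Pi.pow_apply, Pi.sub_apply, hτ0]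
      exact le_mul_of_one_le_left zero_le (one_le_pow₀ hT0)
    calc (T 0 - 1) * T w ≤ T w * M (w - w) := by
          rw [sub_self, mul_comm]; exact mul_le_mul_right hM0 _
      _ ≤ _ := Finset.single_le_sum (f := fun y => T y * M (w - y)) (fun _ _ => zero_le)
          (Finset.mem_univ w)
  refine le_trans ?_ (EReal.coe_ennreal_le_coe_ennreal_iff.2 hBle)
  have e1 : (T x : EReal) = (((T x).toReal : ℝ) : EReal) := by
    rw [← EReal.toReal_coe_ennreal, EReal.coe_toReal] <;> simp [hfin x]
  rw [e1, ← EReal.coe_sub, EReal.coe_ennreal_ofReal, EReal.coe_le_coe_iff]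
  exact key.trans (le_max_left _ _)
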